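/- Let $\mathcal X,\mathcal Y$ be complete separable metric spaces with their Borel $\sigma$-algebras, and let $\mathcal W=\mathcal X\times\mathcal Y$ carry the product metric $d_{\mathcal W}((x,y),(x',y'))=\max\{d_{\mathcal X}(x,x'),d_{\mathcal Y}(y,y')\}$. For Borel probability measures $\mu$ on $\mathcal X$ and $\nu$ on $\mathcal Y$ let $\Pi(\mu,\nu)$ be the set of Borel probability measures on $\mathcal W$ with marginals $\mu$ and $\nu$. For $r\ge 1$ let $\mathcal P_r(\mathcal V)$ be the set of Borel probability measures on a metric space $\mathcal V$ with finite $r$-th moment, and $$W_r(\pi_1,\pi_2)=\Big(\inf_{m\in\Pi(\pi_1,\pi_2)}\int d_{\mathcal V}(u,v)^r\,dm(u,v)\Big)^{1/r}.$$ Let $\sigma:[0,1)\to[0,\infty)$ be nondecreasing, right-continuous and bounded with $\int_0^1\sigma(u)\,du=1$. For a Borel function $L:\mathcal W\to\mathbb R$ and a probability measure $\pi$ on $\mathcal W$ put $$F^{\leftarrow}_{L,\pi}(u)=\inf\{x\in\mathbb R:\pi(L\le x)\ge u\}\ (0<u<1),\qquad R_{\pi,\sigma}(L)=\int_0^1F^{\leftarrow}_{L,\pi}(u)\,\sigma(u)\,du,$$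 and let $V_\sigma(\mu,\nu;L)=\sup_{\pi\in\Pi(\mu,\nu)}R_{\pi,\sigma}(L)$; a maximizer for $V_\sigma(\mu,\nu;L)$ is a $\pi\in\Pi(\mu,\nu)$ attaining this supremum. Proposition. Let $r\ge1$, let $\mu_n,\mu\in\mathcal P_r(\mathcal X)$ and $\nu_n,\nu\in\mathcal P_r(\mathcal Y)$ $(n\in\mathbb N)$ with $W_r(\mu_n,\mu)\to0$ and $W_r(\nu_n,\nu)\to0$. Let $L_n:\mathcal W\to\mathbb R$ be Hölder continuous with exponent $q\in(0,1]$ and constant $C_q$, both independent of $n$, that is, $|L_n(w)-L_n(w')|\le C_q\,d_{\mathcal W}(w,w')^q$ for all $w,w'$ and $n$, and let $L:\mathcal W\to\mathbb R$ be Borel. Suppose that for every $n$, $L_n\in\mathcal L^1(\pi_n)$ for all $\pi_n\in\Pi(\mu_n,\nu_n)$ and $L_n\in\mathcal L^1(\pi)$ for all $\pi\in\Pi(\mu,\nu)$, and that $L_n\to L$ in $\mathcal L^1(\pi)$ for every $\pi\in\Pi(\mu,\nu)$. Then all the values $V_\sigma(\mu_n,\nu_n;L_n)$ and $V_\sigma(\mu,\nu;L)$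 are finite, and $$V_\sigma(\mu_n,\nu_n;L_n)\to V_\sigma(\mu,\nu;L).$$ Moreover, if $\pi_n^*$ is a maximizer for $V_\sigma(\mu_n,\nu_n;L_n)$ for each $n$, then there are a subsequence $(\pi^*_{n_k})_k$ and a maximizer $\pi^*$ for $V_\sigma(\mu,\nu;L)$ such that $W_r(\pi^*_{n_k},\pi^*)\to0$. -/

import Mathlib

open MeasureTheory Filter Set
open scoped Topology NNReal ENNReal

namespace SpectralRisk

/-- `Π(μ, ν)`: the Borel probability measures on the product with first marginal `μ` and
second marginal `ν`. -/
def couplings {X Y : Type*} [MeasurableSpace X] [MeasurableSpace Y]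
    (μ : ProbabilityMeasure X) (ν : ProbabilityMeasure Y) : Set (ProbabilityMeasure (X × Y)) :=
  {π | (π : Measure (X × Y)).map Prod.fst = (μ : Measure X) ∧
       (π : Measure (X × Y)).map Prod.snd = (ν : Measure Y)}

/-- Membership in `𝒫_r(V)`: the probability measure `μ` has a finite `r`-th moment. -/
def HasFiniteMoment {V : Type*} [MetricSpace V] [MeasurableSpace V]
    (r : ℝ) (μ : ProbabilityMeasure V) : Prop :=
  ∃ v₀ : V, ∫⁻ v, edist v₀ v ^ r ∂(μ : Measure V) < ∞

/-- The Wasserstein distance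
`W_r(μ, ν) = (inf_{m ∈ Π(μ, ν)} ∫ d(u, v)^r dm(u, v))^{1/r}`, with values in `[0, ∞]`
(it is finite when both measures have a finite `r`-th moment). -/
noncomputable def wasserstein {V : Type*} [MetricSpace V] [MeasurableSpace V]
    (r : ℝ) (μ ν : ProbabilityMeasure V) : ℝ≥0∞ :=
  (⨅ m ∈ couplings μ ν, ∫⁻ p, edist p.1 p.2 ^ r ∂(m : Measure (V × V))) ^ (1 / r)

/-- The Value-at-Risk (generalized inverse distribution function)
`F⁻¹_{L,π}(α) = inf {x ∈ ℝ : π(L ≤ x) ≥ α}`, for `α ∈ (0, 1)`. -/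
noncomputable def valueAtRisk {Ω : Type*} [MeasurableSpace Ω]
    (π : ProbabilityMeasure Ω) (L : Ω → ℝ) (α : ℝ) : ℝ :=
  sInf {x : ℝ | α ≤ (π : Measure Ω).real {w | L w ≤ x}}

/-- Bounded spectral functions `σ : [0, 1) → [0, ∞)`; only the values on `[0, 1)` matter. -/
structure IsSpectralFunction (σ : ℝ → ℝ) : Prop where
  nonneg : ∀ u ∈ Ico (0 : ℝ) 1, 0 ≤ σ u
  monotoneOn : MonotoneOn σ (Ico (0 : ℝ) 1)
  rightContinuous : ∀ u ∈ Ico (0 : ℝ) 1, ContinuousWithinAt σ (Ici u) u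
  bounded : ∃ M : ℝ, ∀ u ∈ Ico (0 : ℝ) 1, σ u ≤ M
  integral_eq_one : ∫ u in Ioo (0 : ℝ) 1, σ u = 1

/-- The spectral risk measure `R_{π,σ}(L) = ∫₀¹ VaR_{u,π}(L) σ(u) du`. -/
noncomputable def spectralRisk {Ω : Type*} [MeasurableSpace Ω]
    (σ : ℝ → ℝ) (π : ProbabilityMeasure Ω) (L : Ω → ℝ) : ℝ :=
  ∫ u in Ioo (0 : ℝ) 1, valueAtRisk π L u * σ u

/-- The maximum spectral risk measure `V_σ(μ, ν) = sup_{π ∈ Π(μ, ν)} R_{π,σ}(L)` of the loss `L`,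
as a supremum in the extended reals. -/
noncomputable def maxSpectralRisk {X Y : Type*} [MeasurableSpace X] [MeasurableSpace Y]
    (σ : ℝ → ℝ) (L : X × Y → ℝ) (μ : ProbabilityMeasure X) (ν : ProbabilityMeasure Y) : EReal :=
  ⨆ π ∈ couplings μ ν, (spectralRisk σ π L : EReal)

/-- `π` is a maximizer for `V_σ(μ, ν)`: it is feasible and attains the supremum. -/
def IsMaximizer {X Y : Type*} [MeasurableSpace X] [MeasurableSpace Y]
    (σ : ℝ → ℝ) (L : X × Y → ℝ) (μ : ProbabilityMeasure X) (ν : ProbabilityMeasure Y)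
    (π : ProbabilityMeasure (X × Y)) : Prop :=
  π ∈ couplings μ ν ∧ (spectralRisk σ π L : EReal) = maxSpectralRisk σ L μ ν

end SpectralRisk

/-! The quantile map is an `L¹` contraction: on any probability space, `∫₀¹ |F_Z⁻¹ - F_{Z'}⁻¹| du ≤
E|Z - Z'|`. With `σ ≤ M`, the spectral risk is therefore `M`-Lipschitz in `L¹`. It depends only on
the law of the loss, so risks under two measures can be compared on any coupling of them; for a
Hölder loss the difference is at most `M C (∫ d^r dm)^{q/r}`. Hence the risks converge along
couplings converging in `W_r` (`tendsto_spectralRisk`). The limit `L` enters only through `L¹`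
convergence and need not be continuous.

It remains to compare the feasible sets. Gluing moves any coupling of one pair of marginals to a
coupling of a nearby pair at small cost (`exists_coupling_of_marginal_couplings`), and `Π(μ, ν)` is
`W_r`-sequentially compact. Weak compactness is Prokhorov's theorem. The upgrade to `W_r`
(`tendsto_wasserstein_of_tendsto`) couples the common mass inside small cells and the rest
independently; fixed marginals make the moments uniformly integrable.

Recovery sequences then give the lower bound for the limiting values, and compactness gives the
upper bound and the convergence of maximizers. -/

open scoped ProbabilityTheory

namespace SpectralRisk

/-! ### Quantiles and the `L¹` Lipschitz bound for spectral risks -/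

section Quantile

variable {Ω : Type*} [MeasurableSpace Ω]

lemma measureReal_sublevel_eq_cdf (π : ProbabilityMeasure Ω) {Z : Ω → ℝ} (hZ : Measurable Z)
    (x : ℝ) :
    (π : Measure Ω).real {w | Z w ≤ x} = ProbabilityTheory.cdf ((π : Measure Ω).map Z) x := by
  have : IsProbabilityMeasure ((π : Measure Ω).map Z) :=
    Measure.isProbabilityMeasure_map hZ.aemeasurable
  rw [ProbabilityTheory.cdf_eq_real, map_measureReal_apply hZ measurableSet_Iic]
  rfl

/-- For `u` strictly between `0` and `1` the limits of the distribution function make the defining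
set nonempty and bounded below, and right continuity makes its infimum attained. This Galois
connection is the only access to quantiles used below. -/
lemma valueAtRisk_le_iff (π : ProbabilityMeasure Ω) {Z : Ω → ℝ} (hZ : Measurable Z)
    {u : ℝ} (hu : u ∈ Ioo (0 : ℝ) 1) (x : ℝ) :
    valueAtRisk π Z u ≤ x ↔ u ≤ (π : Measure Ω).real {w | Z w ≤ x} := by
  unfold valueAtRisk
  simp only [measureReal_sublevel_eq_cdf π hZ]
  have : IsProbabilityMeasure ((π : Measure Ω).map Z) :=
    Measure.isProbabilityMeasure_map hZ.aemeasurable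
  set F := ProbabilityTheory.cdf ((π : Measure Ω).map Z)
  have hmono : Monotone F := F.mono
  obtain ⟨y, hy⟩ : ∃ y, u ≤ F y :=
    ((ProbabilityTheory.tendsto_cdf_atTop _).eventually (eventually_ge_nhds hu.2)).exists
  obtain ⟨z, hz⟩ : ∃ z, F z < u :=
    ((ProbabilityTheory.tendsto_cdf_atBot _).eventually (eventually_lt_nhds hu.1)).exists
  have hbdd : BddBelow {x | u ≤ F x} :=
    ⟨z, fun x hx => le_of_not_gt fun hlt => absurd (hmono hlt.le) (not_le.2 (hz.trans_le hx))⟩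
  refine ⟨fun h => ?_, fun h => csInf_le hbdd h⟩
  refine le_trans ?_ (hmono h)
  refine ge_of_tendsto ((F.right_continuous _).tendsto.mono_left
    (nhdsWithin_mono _ Ioi_subset_Ici_self)) ?_
  filter_upwards [self_mem_nhdsWithin] with t ht
  obtain ⟨s, hs, hst⟩ := exists_lt_of_csInf_lt ⟨y, hy⟩ ht
  exact le_trans hs (hmono hst.le)

lemma monotoneOn_valueAtRisk (π : ProbabilityMeasure Ω) {Z : Ω → ℝ} (hZ : Measurable Z) :
    MonotoneOn (valueAtRisk π Z) (Ioo 0 1) := fun _ hu _ hv huv =>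
  (valueAtRisk_le_iff π hZ hu _).2 (huv.trans ((valueAtRisk_le_iff π hZ hv _).1 le_rfl))

lemma valueAtRisk_zero (π : ProbabilityMeasure Ω) {u : ℝ} (hu : u ∈ Ioo (0 : ℝ) 1) :
    valueAtRisk π (fun _ => 0) u = 0 := by
  refine eq_of_forall_ge_iff fun x => ?_
  rw [valueAtRisk_le_iff π measurable_const hu]
  by_cases hx : 0 ≤ x
  · simpa [hx] using hu.2.le
  · simpa [hx] using hu.1

lemma edist_eq_volume_separating (a b : ℝ) :
    edist a b = volume {x : ℝ | ¬(a ≤ x ↔ b ≤ x)} := by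
  have : {x : ℝ | ¬(a ≤ x ↔ b ≤ x)} = Ico (min a b) (max a b) := by
    ext x
    simp only [mem_ofPred_eq, mem_Ico, min_le_iff, lt_max_iff]
    grind
  rw [this, Real.volume_Ico, max_sub_min_eq_abs', edist_dist, Real.dist_eq]

/-- Both sides are integrals over levels `x`: a distance between two reals is the length of the set
of levels separating them. After Fubini it suffices that, at each level, the two distribution
functions differ by at most the probability that `x` separates `Z` from `Z'`. -/
lemma lintegral_edist_valueAtRisk_le (π : ProbabilityMeasure Ω) {Z Z' : Ω → ℝ}
    (hZ : Measurable Z) (hZ' : Measurable Z') :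
    ∫⁻ u in Ioo (0 : ℝ) 1, edist (valueAtRisk π Z u) (valueAtRisk π Z' u) ≤
      ∫⁻ w, edist (Z w) (Z' w) ∂(π : Measure Ω) := by
  set F : ℝ → ℝ := fun x => (π : Measure Ω).real {w | Z w ≤ x}
  set F' : ℝ → ℝ := fun x => (π : Measure Ω).real {w | Z' w ≤ x}
  have hF : Measurable F :=
    Monotone.measurable fun x y h => measureReal_mono fun w hw => le_trans hw h
  have hF' : Measurable F' :=
    Monotone.measurable fun x y h => measureReal_mono fun w hw => le_trans hw h
  have hS : MeasurableSet {p : ℝ × ℝ | ¬(p.1 ≤ F p.2 ↔ p.1 ≤ F' p.2)} :=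
    ((measurableSet_le measurable_fst (hF.comp measurable_snd)).iff
      (measurableSet_le measurable_fst (hF'.comp measurable_snd))).compl
  have hT : MeasurableSet {p : Ω × ℝ | ¬(Z p.1 ≤ p.2 ↔ Z' p.1 ≤ p.2)} :=
    ((measurableSet_le (hZ.comp measurable_fst) measurable_snd).iff
      (measurableSet_le (hZ'.comp measurable_fst) measurable_snd)).compl
  calc ∫⁻ u in Ioo (0 : ℝ) 1, edist (valueAtRisk π Z u) (valueAtRisk π Z' u)
      = ∫⁻ u in Ioo (0 : ℝ) 1, volume {x | ¬(u ≤ F x ↔ u ≤ F' x)} := by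
        refine setLIntegral_congr_fun measurableSet_Ioo fun u hu => ?_
        simp only [edist_eq_volume_separating, valueAtRisk_le_iff π hZ hu,
          valueAtRisk_le_iff π hZ' hu, F, F']
    _ = ∫⁻ x, volume.restrict (Ioo (0 : ℝ) 1) {u | ¬(u ≤ F x ↔ u ≤ F' x)} := by
        exact (Measure.prod_apply hS).symm.trans (Measure.prod_apply_symm hS)
    _ ≤ ∫⁻ x, (π : Measure Ω) {w | ¬(Z w ≤ x ↔ Z' w ≤ x)} := by
        refine lintegral_mono fun x => ?_
        have hZx : MeasurableSet {w | Z w ≤ x} := hZ measurableSet_Iic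
        have hZx' : MeasurableSet {w | Z' w ≤ x} := hZ' measurableSet_Iic
        calc volume.restrict (Ioo (0 : ℝ) 1) {u | ¬(u ≤ F x ↔ u ≤ F' x)}
            ≤ volume (Ioc (min (F x) (F' x)) (max (F x) (F' x))) := by
              refine (Measure.restrict_apply_le _ _).trans (measure_mono fun u hu => ?_)
              simp only [mem_ofPred_eq, mem_Ioc, min_lt_iff, le_max_iff] at hu ⊢
              grind
          _ = ENNReal.ofReal |F' x - F x| := by
              rw [Real.volume_Ioc, max_sub_min_eq_abs]
          _ ≤ ENNReal.ofReal ((π : Measure Ω).real {w | ¬(Z w ≤ x ↔ Z' w ≤ x)}) := by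
              refine ENNReal.ofReal_le_ofReal ?_
              have := abs_measureReal_sub_le_measureReal_symmDiff
                (μ := (π : Measure Ω)) hZx'.nullMeasurableSet hZx.nullMeasurableSet
              refine this.trans (measureReal_mono fun w hw => ?_)
              simp only [Set.mem_symmDiff, mem_ofPred_eq] at hw ⊢
              tauto
          _ = _ := ENNReal.ofReal_toReal (measure_ne_top _ _)
    _ = ∫⁻ w, edist (Z w) (Z' w) ∂(π : Measure Ω) := by
        simp only [edist_eq_volume_separating]
        exact (Measure.prod_apply_symm hT).symm.trans (Measure.prod_apply hT)

lemma IsSpectralFunction.aemeasurable {σ : ℝ → ℝ} (hσ : IsSpectralFunction σ) :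
    AEMeasurable σ (volume.restrict (Ioo (0 : ℝ) 1)) :=
  aemeasurable_restrict_of_monotoneOn measurableSet_Ioo
    (hσ.monotoneOn.mono Ioo_subset_Ico_self)

lemma IsSpectralFunction.exists_bound {σ : ℝ → ℝ} (hσ : IsSpectralFunction σ) :
    ∃ M : ℝ≥0, ∀ u ∈ Ioo (0 : ℝ) 1, ‖σ u‖ₑ ≤ M := by
  obtain ⟨M, hM⟩ := hσ.bounded
  refine ⟨M.toNNReal, fun u hu => ?_⟩
  rw [Real.enorm_of_nonneg (hσ.nonneg u (Ioo_subset_Ico_self hu))]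
  exact ENNReal.ofReal_le_ofReal (hM u (Ioo_subset_Ico_self hu))

lemma integrable_valueAtRisk_mul (π : ProbabilityMeasure Ω) {Z : Ω → ℝ}
    (hZ : Measurable Z) (hZi : Integrable Z (π : Measure Ω)) {σ : ℝ → ℝ}
    (hσ : IsSpectralFunction σ) :
    Integrable (fun u => valueAtRisk π Z u * σ u) (volume.restrict (Ioo (0 : ℝ) 1)) := by
  obtain ⟨M, hM⟩ := hσ.exists_bound
  have hV : Integrable (valueAtRisk π Z) (volume.restrict (Ioo (0 : ℝ) 1)) := by
    refine ⟨(aemeasurable_restrict_of_monotoneOn measurableSet_Ioo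
      (monotoneOn_valueAtRisk π hZ)).aestronglyMeasurable, ?_⟩
    refine lt_of_le_of_lt ?_ hZi.2
    -- Integrability is the contraction estimate against the zero loss, whose quantiles vanish.
    calc ∫⁻ u in Ioo (0 : ℝ) 1, ‖valueAtRisk π Z u‖ₑ
        = ∫⁻ u in Ioo (0 : ℝ) 1, edist (valueAtRisk π Z u) (valueAtRisk π (fun _ => 0) u) := by
          refine setLIntegral_congr_fun measurableSet_Ioo fun u hu => ?_
          simp only [valueAtRisk_zero π hu, edist_zero_right]
      _ ≤ _ := lintegral_edist_valueAtRisk_le π hZ measurable_const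
      _ = _ := by simp only [edist_zero_right]
  refine hV.mul_bdd (c := M) hσ.aemeasurable.aestronglyMeasurable ?_
  filter_upwards [ae_restrict_mem measurableSet_Ioo] with u hu
  have := hM u hu
  exact_mod_cast this

lemma edist_spectralRisk_le (π : ProbabilityMeasure Ω) {Z Z' : Ω → ℝ}
    (hZ : Measurable Z) (hZ' : Measurable Z') (hZi : Integrable Z (π : Measure Ω))
    (hZi' : Integrable Z' (π : Measure Ω)) {σ : ℝ → ℝ} (hσ : IsSpectralFunction σ)
    {M : ℝ≥0} (hM : ∀ u ∈ Ioo (0 : ℝ) 1, ‖σ u‖ₑ ≤ M) :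
    edist (spectralRisk σ π Z) (spectralRisk σ π Z') ≤
      M * ∫⁻ w, edist (Z w) (Z' w) ∂(π : Measure Ω) := by
  unfold spectralRisk
  rw [edist_eq_enorm_sub, ← integral_sub (integrable_valueAtRisk_mul π hZ hZi hσ)
    (integrable_valueAtRisk_mul π hZ' hZi' hσ)]
  calc _ ≤ ∫⁻ u in Ioo (0 : ℝ) 1, ‖valueAtRisk π Z u * σ u - valueAtRisk π Z' u * σ u‖ₑ :=
        enorm_integral_le_lintegral_enorm _
    _ ≤ ∫⁻ u in Ioo (0 : ℝ) 1, M * edist (valueAtRisk π Z u) (valueAtRisk π Z' u) := by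
        refine setLIntegral_mono' measurableSet_Ioo fun u hu => ?_
        rw [← sub_mul, enorm_mul, mul_comm, ← edist_eq_enorm_sub]
        gcongr
        exact hM u hu
    _ = M * ∫⁻ u in Ioo (0 : ℝ) 1, edist (valueAtRisk π Z u) (valueAtRisk π Z' u) :=
        lintegral_const_mul' _ _ ENNReal.coe_ne_top
    _ ≤ _ := by gcongr; exact lintegral_edist_valueAtRisk_le π hZ hZ'

lemma spectralRisk_comp_of_map_eq {Ω' : Type*} [MeasurableSpace Ω'] {m : ProbabilityMeasure Ω'}
    {π : ProbabilityMeasure Ω} {f : Ω' → Ω} (hf : Measurable f)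
    (h : (m : Measure Ω').map f = π) {Z : Ω → ℝ} (hZ : Measurable Z) (σ : ℝ → ℝ) :
    spectralRisk σ m (Z ∘ f) = spectralRisk σ π Z := by
  have key (x : ℝ) : (m : Measure Ω').real {w | (Z ∘ f) w ≤ x} =
      (π : Measure Ω).real {w | Z w ≤ x} := by
    rw [← h]
    exact (map_measureReal_apply hf (hZ measurableSet_Iic)).symm
  simp only [spectralRisk, valueAtRisk, key]

/-- Law invariance lifts both losses to the coupling space, where the estimate for a single measure
applies. -/
lemma edist_spectralRisk_le_of_mem_couplings {Ω' : Type*} [MeasurableSpace Ω']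
    {π : ProbabilityMeasure Ω} {π' : ProbabilityMeasure Ω'} {m : ProbabilityMeasure (Ω × Ω')}
    (hm : m ∈ couplings π π') {Z : Ω → ℝ} {Z' : Ω' → ℝ}
    (hZ : Measurable Z) (hZ' : Measurable Z') (hZi : Integrable Z (π : Measure Ω))
    (hZi' : Integrable Z' (π' : Measure Ω')) {σ : ℝ → ℝ} (hσ : IsSpectralFunction σ)
    {M : ℝ≥0} (hM : ∀ u ∈ Ioo (0 : ℝ) 1, ‖σ u‖ₑ ≤ M) :
    edist (spectralRisk σ π Z) (spectralRisk σ π' Z') ≤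
      M * ∫⁻ p, edist (Z p.1) (Z' p.2) ∂(m : Measure (Ω × Ω')) := by
  rw [← spectralRisk_comp_of_map_eq measurable_fst hm.1 hZ,
    ← spectralRisk_comp_of_map_eq measurable_snd hm.2 hZ']
  refine edist_spectralRisk_le m (hZ.comp measurable_fst) (hZ'.comp measurable_snd) ?_ ?_ hσ hM
  · exact (hm.1 ▸ hZi).comp_measurable measurable_fst
  · exact (hm.2 ▸ hZi').comp_measurable measurable_snd

end Quantile

/-! ### Gluing couplings along a common marginal -/

section Gluing

variable {A B C : Type*} [MeasurableSpace A] [MeasurableSpace B] [MeasurableSpace C]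

/-- Disintegrate `m'` over `B` and run its conditional kernel from the `B`-coordinate of `m`, making
the outer coordinates conditionally independent. -/
lemma exists_glue [StandardBorelSpace C] [Nonempty C] (m : ProbabilityMeasure (A × B))
    (m' : ProbabilityMeasure (B × C))
    (h : (m : Measure (A × B)).map Prod.snd = (m' : Measure (B × C)).map Prod.fst) :
    ∃ M : ProbabilityMeasure ((A × B) × C),
      (M : Measure ((A × B) × C)).map Prod.fst = m ∧
      (M : Measure ((A × B) × C)).map (fun p => (p.1.2, p.2)) = m' := by
  set κ := (m' : Measure (B × C)).condKernel
  refine ⟨⟨(m : Measure (A × B)) ⊗ₘ (κ.comap Prod.snd measurable_snd), inferInstance⟩, ?_, ?_⟩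
  · exact Measure.fst_compProd _ _
  · have hdis : (m' : Measure (B × C)).fst ⊗ₘ κ = m' :=
      (m' : Measure (B × C)).disintegrate _
    refine Measure.ext fun s hs => ?_
    have hmeas : Measurable fun p : (A × B) × C => (p.1.2, p.2) := by fun_prop
    change Measure.map _ ((m : Measure (A × B)) ⊗ₘ (κ.comap Prod.snd measurable_snd)) s = _
    rw [Measure.map_apply hmeas hs, Measure.compProd_apply (hmeas hs), ← hdis,
      Measure.compProd_apply hs, Measure.fst, ← h,
      lintegral_map (ProbabilityTheory.Kernel.measurable_kernel_prodMk_left hs) measurable_snd]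
    rfl

/-- The image of a probability measure under a measurable map. -/
noncomputable def pushforward {α β : Type*} [MeasurableSpace α] [MeasurableSpace β]
    (m : ProbabilityMeasure α) {f : α → β} (hf : Measurable f) : ProbabilityMeasure β :=
  m.map hf.aemeasurable

lemma coe_pushforward {α β : Type*} [MeasurableSpace α] [MeasurableSpace β]
    (m : ProbabilityMeasure α) {f : α → β} (hf : Measurable f) :
    (pushforward m hf : Measure β) = (m : Measure α).map f := rfl

end Gluing

/-! ### Transport costs of glued couplings -/

lemma edist_rpow_le_two_rpow_mul_add {V : Type*} [PseudoEMetricSpace V] {r : ℝ} (hr : 0 ≤ r)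
    (x y z : V) : edist x z ^ r ≤ 2 ^ r * (edist x y ^ r + edist y z ^ r) := by
  calc edist x z ^ r ≤ (2 * max (edist x y) (edist y z)) ^ r := by
        refine ENNReal.rpow_le_rpow ((edist_triangle x y z).trans ?_) hr
        rw [two_mul]
        exact add_le_add (le_max_left _ _) (le_max_right _ _)
    _ = 2 ^ r * max (edist x y) (edist y z) ^ r := ENNReal.mul_rpow_of_nonneg _ _ hr
    _ ≤ _ := by
        gcongr
        rcases max_cases (edist x y) (edist y z) with h | h <;> rw [h.1] <;> simp

lemma edist_prod_rpow_le {X Y : Type*} [PseudoEMetricSpace X] [PseudoEMetricSpace Y] {r : ℝ}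
    (p p' : X × Y) :
    edist p p' ^ r ≤ edist p.1 p'.1 ^ r + edist p.2 p'.2 ^ r := by
  rw [Prod.edist_eq]
  rcases max_cases (edist p.1 p'.1) (edist p.2 p'.2) with h | h <;> rw [h.1] <;> simp

/-- A quasi-triangle inequality for costs. The factor `2 ^ r` is harmless because only convergence
of costs to zero is needed. -/
lemma exists_coupling_cost_le_of_couplings {V : Type*} [MetricSpace V] [CompleteSpace V]
    [SecondCountableTopology V] [MeasurableSpace V] [BorelSpace V] {r : ℝ} (hr : 0 ≤ r)
    {a b c : ProbabilityMeasure V} {m m' : ProbabilityMeasure (V × V)}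
    (hm : m ∈ couplings a b) (hm' : m' ∈ couplings b c) :
    ∃ M ∈ couplings a c, ∫⁻ p, edist p.1 p.2 ^ r ∂(M : Measure (V × V)) ≤
      2 ^ r * (∫⁻ p, edist p.1 p.2 ^ r ∂(m : Measure (V × V)) +
        ∫⁻ p, edist p.1 p.2 ^ r ∂(m' : Measure (V × V))) := by
  have : Nonempty V := ⟨(nonempty_of_isProbabilityMeasure (c : Measure V)).some⟩
  obtain ⟨N, hN, hN'⟩ := exists_glue m m' (hm.2.trans hm'.1.symm)
  have hf : Measurable fun p : (V × V) × V => (p.1.1, p.2) := by fun_prop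
  have hg : Measurable fun p : (V × V) × V => (p.1.2, p.2) := by fun_prop
  have hcost : Measurable fun p : V × V => edist p.1 p.2 ^ r :=
    (measurable_fst.edist measurable_snd).pow_const r
  have hc1 : Measurable fun p : (V × V) × V => edist p.1.1 p.1.2 ^ r := hcost.comp measurable_fst
  have hc2 : Measurable fun p : (V × V) × V => edist p.1.2 p.2 ^ r := hcost.comp hg
  refine ⟨pushforward N hf, ⟨?_, ?_⟩, ?_⟩
  · rw [coe_pushforward, Measure.map_map measurable_fst hf, ← hm.1, ← hN,
      Measure.map_map measurable_fst measurable_fst]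
    rfl
  · rw [coe_pushforward, Measure.map_map measurable_snd hf, ← hm'.2, ← hN',
      Measure.map_map measurable_snd hg]
    rfl
  · rw [coe_pushforward, lintegral_map hcost hf, ← hN, ← hN', lintegral_map hcost hg,
      lintegral_map hcost measurable_fst, ← lintegral_add_left hc1,
      ← lintegral_const_mul' _ _ (ENNReal.rpow_ne_top_of_nonneg hr ENNReal.ofNat_ne_top)]
    exact lintegral_mono fun p => edist_rpow_le_two_rpow_mul_add hr _ _ _

/-- Glue `b` to `π` along the second coordinate, then `a` along the first. For the maximum metric
the cost of the joint displacement is at most the sum of the marginal costs. -/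
lemma exists_coupling_of_marginal_couplings {X Y : Type*}
    [MetricSpace X] [CompleteSpace X] [SecondCountableTopology X]
    [MeasurableSpace X] [BorelSpace X]
    [MetricSpace Y] [CompleteSpace Y] [SecondCountableTopology Y]
    [MeasurableSpace Y] [BorelSpace Y] {r : ℝ}
    {μ μ' : ProbabilityMeasure X} {ν ν' : ProbabilityMeasure Y}
    {π : ProbabilityMeasure (X × Y)} (hπ : π ∈ couplings μ ν)
    {a : ProbabilityMeasure (X × X)} (ha : a ∈ couplings μ μ')
    {b : ProbabilityMeasure (Y × Y)} (hb : b ∈ couplings ν ν') :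
    ∃ π' ∈ couplings μ' ν', ∃ m ∈ couplings π π',
      ∫⁻ p, edist p.1 p.2 ^ r ∂(m : Measure ((X × Y) × (X × Y))) ≤
        ∫⁻ p, edist p.1 p.2 ^ r ∂(a : Measure (X × X)) +
        ∫⁻ p, edist p.1 p.2 ^ r ∂(b : Measure (Y × Y)) := by
  have : Nonempty X := ⟨(nonempty_of_isProbabilityMeasure (μ : Measure X)).some⟩
  have : Nonempty Y := ⟨(nonempty_of_isProbabilityMeasure (ν : Measure Y)).some⟩
  obtain ⟨N, hN, hNb⟩ := exists_glue π b (hπ.2.trans hb.1.symm)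
  have hf : Measurable fun p : (X × Y) × Y => ((p.1.2, p.2), p.1.1) := by fun_prop
  have hg : Measurable fun p : (X × Y) × Y => (p.1.2, p.2) := by fun_prop
  have hN1 : (N : Measure ((X × Y) × Y)).map (fun p => p.1.1) = μ := by
    rw [← hπ.1, ← hN, Measure.map_map measurable_fst measurable_fst]
    rfl
  obtain ⟨K, hK, hKa⟩ := exists_glue (pushforward N hf) a (by
    rw [ha.1, ← hN1, coe_pushforward, Measure.map_map measurable_snd hf]
    rfl)
  -- points of `K` are `(((y, y'), x), x')`
  have h1 : Measurable fun p : ((Y × Y) × X) × X => (p.1.2, p.1.1.1) := by fun_prop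
  have h2 : Measurable fun p : ((Y × Y) × X) × X => (p.2, p.1.1.2) := by fun_prop
  have h3 : Measurable fun p : ((Y × Y) × X) × X => (p.1.2, p.2) := by fun_prop
  have h12 := h1.prodMk h2
  have hKN : (K : Measure (((Y × Y) × X) × X)).map (fun p => p.1.1) =
      (N : Measure ((X × Y) × Y)).map (fun p => (p.1.2, p.2)) := by
    have : (K : Measure (((Y × Y) × X) × X)).map (fun p => p.1.1) =
        ((K : Measure (((Y × Y) × X) × X)).map Prod.fst).map Prod.fst := by
      rw [Measure.map_map measurable_fst measurable_fst]; rfl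
    rw [this, hK, coe_pushforward, Measure.map_map measurable_fst hf]
    rfl
  have hKb : (K : Measure (((Y × Y) × X) × X)).map (fun p => p.1.1) = b := by rw [hKN, hNb]
  have hKπ : (K : Measure (((Y × Y) × X) × X)).map (fun p => (p.1.2, p.1.1.1)) = π := by
    have hs : Measurable fun p : (Y × Y) × X => (p.2, p.1.1) := by fun_prop
    have : (K : Measure (((Y × Y) × X) × X)).map (fun p => (p.1.2, p.1.1.1)) =
        ((K : Measure (((Y × Y) × X) × X)).map Prod.fst).map (fun p => (p.2, p.1.1)) := by
      rw [Measure.map_map hs measurable_fst]; rfl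
    rw [this, hK, coe_pushforward, Measure.map_map hs hf, ← hN]
    rfl
  refine ⟨pushforward K h2, ⟨?_, ?_⟩, pushforward K h12, ⟨?_, ?_⟩, ?_⟩
  · rw [coe_pushforward, Measure.map_map measurable_fst h2, ← ha.2, ← hKa,
      Measure.map_map measurable_snd h3]
    rfl
  · rw [coe_pushforward, Measure.map_map measurable_snd h2, ← hb.2, ← hKb,
      Measure.map_map measurable_snd (by fun_prop)]
    rfl
  · rw [coe_pushforward, Measure.map_map measurable_fst h12, ← hKπ]
    rfl
  · rw [coe_pushforward, coe_pushforward, Measure.map_map measurable_snd h12]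
    rfl
  · have hcX : Measurable fun p : X × X => edist p.1 p.2 ^ r :=
      (measurable_fst.edist measurable_snd).pow_const r
    have hcY : Measurable fun p : Y × Y => edist p.1 p.2 ^ r :=
      (measurable_fst.edist measurable_snd).pow_const r
    have hcW : Measurable fun p : (X × Y) × (X × Y) => edist p.1 p.2 ^ r :=
      (measurable_fst.edist measurable_snd).pow_const r
    have hc3 : Measurable fun p : ((Y × Y) × X) × X => edist p.1.2 p.2 ^ r := hcX.comp h3
    rw [coe_pushforward, lintegral_map hcW h12, ← hKa, ← hKb, lintegral_map hcX h3,
      lintegral_map hcY (by fun_prop), ← lintegral_add_left hc3]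
    exact lintegral_mono fun p => edist_prod_rpow_le _ _

lemma swap_mem_couplings {A B : Type*} [MeasurableSpace A] [MeasurableSpace B]
    {a : ProbabilityMeasure A} {b : ProbabilityMeasure B} {m : ProbabilityMeasure (A × B)}
    (hm : m ∈ couplings a b) : pushforward m measurable_swap ∈ couplings b a := by
  refine ⟨?_, ?_⟩
  · rw [coe_pushforward, Measure.map_map measurable_fst measurable_swap, ← hm.2]; rfl
  · rw [coe_pushforward, Measure.map_map measurable_snd measurable_swap, ← hm.1]; rfl

lemma lintegral_edist_rpow_pushforward_swap {V : Type*} [MetricSpace V]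
    [SecondCountableTopology V] [MeasurableSpace V] [BorelSpace V] (r : ℝ)
    (m : ProbabilityMeasure (V × V)) :
    ∫⁻ p, edist p.1 p.2 ^ r ∂(pushforward m measurable_swap : Measure (V × V)) =
      ∫⁻ p, edist p.1 p.2 ^ r ∂(m : Measure (V × V)) := by
  rw [coe_pushforward,
    lintegral_map ((measurable_fst.edist measurable_snd).pow_const r) measurable_swap]
  simp [edist_comm]

lemma prod_mem_couplings {A B : Type*} [MeasurableSpace A] [MeasurableSpace B]
    (a : ProbabilityMeasure A) (b : ProbabilityMeasure B) : a.prod b ∈ couplings a b := by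
  refine ⟨?_, ?_⟩
  · simp [ProbabilityMeasure.toMeasure_prod]
  · simp [ProbabilityMeasure.toMeasure_prod]

lemma exists_couplings_tendsto_of_tendsto_wasserstein {V : Type*} [MetricSpace V]
    [MeasurableSpace V] {r : ℝ} (hr : 0 < r)
    {a b : ℕ → ProbabilityMeasure V}
    (h : Tendsto (fun n => wasserstein r (a n) (b n)) atTop (𝓝 0)) :
    ∃ m : ℕ → ProbabilityMeasure (V × V), (∀ n, m n ∈ couplings (a n) (b n)) ∧
      Tendsto (fun n => ∫⁻ p, edist p.1 p.2 ^ r ∂(m n : Measure (V × V))) atTop (𝓝 0) := by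
  set I : ℕ → ℝ≥0∞ := fun n =>
    ⨅ m ∈ couplings (a n) (b n), ∫⁻ p, edist p.1 p.2 ^ r ∂(m : Measure (V × V))
  have hI : Tendsto I atTop (𝓝 0) := by
    have := (ENNReal.continuous_rpow_const (y := r)).tendsto 0 |>.comp h
    rw [ENNReal.zero_rpow_of_pos hr] at this
    refine this.congr fun n => ?_
    change ((I n) ^ (1 / r)) ^ r = I n
    rw [← ENNReal.rpow_mul, one_div, inv_mul_cancel₀ hr.ne', ENNReal.rpow_one]
  -- Couplings that are optimal up to `1 / (n + 1)` suffice, so no optimal plan is required; if the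
  -- infimum is infinite, the product coupling serves.
  have hex (n : ℕ) : ∃ m ∈ couplings (a n) (b n),
      ∫⁻ p, edist p.1 p.2 ^ r ∂(m : Measure (V × V)) ≤ I n + ((n : ℝ≥0∞) + 1)⁻¹ := by
    by_cases hn : I n = ∞
    · exact ⟨_, prod_mem_couplings _ _, by simp [hn]⟩
    · have : I n < I n + ((n : ℝ≥0∞) + 1)⁻¹ := by
        refine ENNReal.lt_add_right hn (ENNReal.inv_ne_zero.2 ?_)
        exact ENNReal.add_ne_top.2 ⟨ENNReal.natCast_ne_top n, ENNReal.one_ne_top⟩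
      obtain ⟨m, hm⟩ := iInf_lt_iff.1 this
      obtain ⟨hm, hlt⟩ := iInf_lt_iff.1 hm
      exact ⟨m, hm, hlt.le⟩
  choose m hm hle using hex
  refine ⟨m, hm, tendsto_of_tendsto_of_tendsto_of_le_of_le tendsto_const_nhds ?_
    (fun _ => zero_le) hle⟩
  have h0 : Tendsto (fun n : ℕ => ((n : ℝ≥0∞) + 1)⁻¹) atTop (𝓝 0) := by
    have := (tendsto_add_atTop_iff_nat 1).2 ENNReal.tendsto_inv_nat_nhds_zero
    simpa using this
  simpa using hI.add h0

lemma tendsto_wasserstein_of_couplings {V : Type*} [MetricSpace V]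
    [MeasurableSpace V] {r : ℝ} (hr : 0 < r)
    {a b : ℕ → ProbabilityMeasure V} {m : ℕ → ProbabilityMeasure (V × V)}
    (hm : ∀ n, m n ∈ couplings (a n) (b n))
    (h : Tendsto (fun n => ∫⁻ p, edist p.1 p.2 ^ r ∂(m n : Measure (V × V))) atTop (𝓝 0)) :
    Tendsto (fun n => wasserstein r (a n) (b n)) atTop (𝓝 0) := by
  have hr' : 0 < 1 / r := by positivity
  have := (ENNReal.continuous_rpow_const (y := 1 / r)).tendsto 0 |>.comp h
  rw [ENNReal.zero_rpow_of_pos hr'] at this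
  refine tendsto_of_tendsto_of_tendsto_of_le_of_le tendsto_const_nhds this (fun _ => zero_le)
    fun n => ?_
  exact ENNReal.rpow_le_rpow (iInf₂_le (m n) (hm n)) hr'.le

/-! ### The overlap coupling of two measures on a countable partition -/

section Overlap

/-- The relative excess of `p k` over the common part `min (p k) (q k)`. -/
noncomputable def excess (p q : ℕ → ℝ≥0∞) (k : ℕ) : ℝ≥0∞ := 1 - min (p k) (q k) / p k

/-- The total mass of `p` that is not shared with `q`. -/
noncomputable def deficit (p q : ℕ → ℝ≥0∞) : ℝ≥0∞ := 1 - ∑' k, min (p k) (q k)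

/-- The density, with respect to the product of `p` and `q`, of the coupling that keeps the common
part on the diagonal and couples the remainders independently. -/
noncomputable def overlapDensity (p q : ℕ → ℝ≥0∞) (k l : ℕ) : ℝ≥0∞ :=
  (if k = l then min (p k) (q k) / (p k * q l) else 0) +
    excess p q k * excess q p l * (deficit p q)⁻¹

lemma deficit_comm (p q : ℕ → ℝ≥0∞) : deficit p q = deficit q p := by
  simp only [deficit, min_comm]

lemma overlapDensity_comm (p q : ℕ → ℝ≥0∞) (k l : ℕ) :
    overlapDensity p q k l = overlapDensity q p l k := by
  unfold overlapDensity
  rw [deficit_comm p q, mul_comm (excess p q k)]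
  congr 1
  by_cases h : k = l
  · subst h; simp [min_comm, mul_comm]
  · simp [h, Ne.symm h]

lemma min_div_le_one (a b : ℝ≥0∞) : min a b / a ≤ 1 :=
  ENNReal.div_le_of_le_mul (by rw [one_mul]; exact min_le_left _ _)

lemma excess_le_one (p q : ℕ → ℝ≥0∞) (k : ℕ) : excess p q k ≤ 1 := tsub_le_self

variable {p q : ℕ → ℝ≥0∞}

lemma ne_top_of_tsum_eq_one (hp : ∑' k, p k = 1) (k : ℕ) : p k ≠ ∞ :=
  ne_top_of_le_ne_top ENNReal.one_ne_top (hp ▸ ENNReal.le_tsum k)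

lemma tsum_excess_mul (hp : ∑' k, p k = 1) : ∑' k, excess p q k * p k = deficit p q := by
  have h (k : ℕ) : excess p q k * p k = p k - min (p k) (q k) := by
    have hk := ne_top_of_tsum_eq_one hp k
    rw [excess, ENNReal.sub_mul fun _ _ => hk, one_mul]
    by_cases h0 : p k = 0
    · simp [h0]
    · rw [ENNReal.div_mul_cancel h0 hk]
  have hle : ∑' k, min (p k) (q k) ≤ 1 := hp ▸ ENNReal.tsum_le_tsum fun k => min_le_left _ _
  simp only [h]
  rw [ENNReal.tsum_sub (ne_top_of_le_ne_top ENNReal.one_ne_top hle)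
    (fun k => min_le_left _ _), hp, deficit]

lemma deficit_mul_inv_le_one (p q : ℕ → ℝ≥0∞) : deficit p q * (deficit p q)⁻¹ ≤ 1 := by
  rw [← div_eq_mul_inv]; exact ENNReal.div_self_le_one

/-- The marginal condition at the level of cells: the diagonal part contributes the shared fraction
of `p k`, and the independent part contributes the complementary fraction `excess p q k`. -/
lemma tsum_overlapDensity_mul (hp : ∑' k, p k = 1) (hq : ∑' k, q k = 1) {k : ℕ} (hk : p k ≠ 0) :
    ∑' l, overlapDensity p q k l * q l = 1 := by
  have hk' := ne_top_of_tsum_eq_one hp k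
  have hq' := ne_top_of_tsum_eq_one hq k
  simp only [overlapDensity, add_mul]
  rw [ENNReal.tsum_add, tsum_eq_single k (by intro l hl; simp [Ne.symm hl])]
  have h1 : (if k = k then min (p k) (q k) / (p k * q k) else 0) * q k =
      min (p k) (q k) / p k := by
    by_cases h0 : q k = 0
    · simp [h0]
    · rw [if_pos rfl, ENNReal.div_eq_inv_mul, ENNReal.mul_inv (Or.inl hk) (Or.inl hk'),
        ENNReal.div_eq_inv_mul, mul_right_comm, mul_assoc (p k)⁻¹, ENNReal.inv_mul_cancel h0 hq',
        mul_one]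
  have h2 : ∑' l, excess p q k * excess q p l * (deficit p q)⁻¹ * q l = excess p q k := by
    have : ∀ l, excess p q k * excess q p l * (deficit p q)⁻¹ * q l =
        (excess p q k * (deficit p q)⁻¹) * (excess q p l * q l) := fun l => by ring
    simp only [this]
    rw [ENNReal.tsum_mul_left, tsum_excess_mul hq, deficit_comm q p, mul_assoc]
    by_cases h0 : deficit p q = 0
    -- With zero deficit the factor `(deficit p q)⁻¹` is infinite, but the excess vanishes on every
    -- charged cell and the product is `0`.
    · have : excess p q k * p k ≤ 0 := by
        rw [← h0, ← tsum_excess_mul hp]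
        exact ENNReal.le_tsum k
      have : excess p q k = 0 := (mul_eq_zero.1 (nonpos_iff_eq_zero.1 this)).resolve_right hk
      simp [this]
    · rw [ENNReal.inv_mul_cancel h0
        (ne_top_of_le_ne_top ENNReal.one_ne_top tsub_le_self), mul_one]
  rw [h1, h2, excess, add_tsub_cancel_of_le (min_div_le_one _ _)]

variable {V : Type*} [MeasurableSpace V]

lemma lintegral_comp_nat (P : Measure V) {T : V → ℕ} (hT : Measurable T) (h : ℕ → ℝ≥0∞) :
    ∫⁻ w, h (T w) ∂P = ∑' k, h k * P (T ⁻¹' {k}) := by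
  rw [← lintegral_map (measurable_of_countable h) hT, lintegral_countable']
  simp only [Measure.map_apply hT (measurableSet_singleton _)]

lemma tsum_measure_fiber (P : Measure V) [IsProbabilityMeasure P] {T : V → ℕ}
    (hT : Measurable T) : ∑' k, P (T ⁻¹' {k}) = 1 := by
  have := lintegral_comp_nat P hT fun _ => 1
  simpa using this.symm

lemma ae_measure_fiber_ne_zero (P : Measure V) {T : V → ℕ} :
    ∀ᵐ w ∂P, P (T ⁻¹' {T w}) ≠ 0 := by
  have h : ∀ᵐ w ∂P, ∀ k, P (T ⁻¹' {k}) = 0 → T w ≠ k := by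
    refine ae_all_iff.2 fun k => ?_
    by_cases hk : P (T ⁻¹' {k}) = 0
    · filter_upwards [measure_eq_zero_iff_ae_notMem.1 hk] with w hw _
      exact hw
    · exact Eventually.of_forall fun w h => absurd h hk
  filter_upwards [h] with w hw h0
  exact hw _ h0 rfl

/-- Mass staying in its cell costs at most `η`. The remaining mass is coupled independently, so
bounding its cost by `D w + D w'` leaves only integrals of `D` against the two excesses. -/
lemma exists_overlap_coupling (P Q : ProbabilityMeasure V) {T : V → ℕ} (hT : Measurable T)
    {c : V × V → ℝ≥0∞} {D : V → ℝ≥0∞} (hD : Measurable D) {η : ℝ≥0∞}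
    (hη : ∀ w w', T w = T w' → c (w, w') ≤ η) (hcD : ∀ w w', c (w, w') ≤ D w + D w') :
    ∃ m ∈ couplings P Q, ∫⁻ z, c z ∂(m : Measure (V × V)) ≤ η +
      (∫⁻ w, D w * excess (fun k => (P : Measure V) (T ⁻¹' {k}))
          (fun k => (Q : Measure V) (T ⁻¹' {k})) (T w) ∂(P : Measure V) +
        ∫⁻ w, D w * excess (fun k => (Q : Measure V) (T ⁻¹' {k}))
          (fun k => (P : Measure V) (T ⁻¹' {k})) (T w) ∂(Q : Measure V)) := by
  set p : ℕ → ℝ≥0∞ := fun k => (P : Measure V) (T ⁻¹' {k})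
  set q : ℕ → ℝ≥0∞ := fun k => (Q : Measure V) (T ⁻¹' {k})
  have hp : ∑' k, p k = 1 := tsum_measure_fiber _ hT
  have hq : ∑' k, q k = 1 := tsum_measure_fiber _ hT
  set G : V × V → ℝ≥0∞ := fun z => overlapDensity p q (T z.1) (T z.2) with hG
  have hGm : Measurable G :=
    (measurable_of_countable fun i : ℕ × ℕ => overlapDensity p q i.1 i.2).comp
      ((hT.comp measurable_fst).prodMk (hT.comp measurable_snd))
  have hfst : ∀ᵐ w ∂(P : Measure V), ∫⁻ w', G (w, w') ∂(Q : Measure V) = 1 := by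
    filter_upwards [ae_measure_fiber_ne_zero (P : Measure V) (T := T)] with w hw
    exact (lintegral_comp_nat _ hT _).trans (tsum_overlapDensity_mul hp hq hw)
  have hsnd : ∀ᵐ w' ∂(Q : Measure V), ∫⁻ w, G (w, w') ∂(P : Measure V) = 1 := by
    filter_upwards [ae_measure_fiber_ne_zero (Q : Measure V) (T := T)] with w hw
    simp only [hG, overlapDensity_comm p q]
    exact (lintegral_comp_nat _ hT _).trans (tsum_overlapDensity_mul hq hp hw)
  set m : Measure (V × V) := ((P : Measure V).prod Q).withDensity G with hm
  have hm1 : m.map Prod.fst = P := by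
    refine Measure.ext fun s hs => ?_
    rw [Measure.map_apply measurable_fst hs, hm, withDensity_apply _ (measurable_fst hs),
      ← prod_univ, ← Measure.prod_restrict, lintegral_prod _ hGm.aemeasurable,
      Measure.restrict_univ, lintegral_congr_ae (ae_restrict_of_ae hfst)]
    simp
  have hm2 : m.map Prod.snd = Q := by
    refine Measure.ext fun s hs => ?_
    rw [Measure.map_apply measurable_snd hs, hm, withDensity_apply _ (measurable_snd hs),
      ← univ_prod, ← Measure.prod_restrict, lintegral_prod_symm _ hGm.aemeasurable,
      Measure.restrict_univ, lintegral_congr_ae (ae_restrict_of_ae hsnd)]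
    simp
  have hprob : IsProbabilityMeasure m := by
    refine ⟨?_⟩
    have := congrArg (fun ρ : Measure V => ρ univ) hm1
    simpa [Measure.map_apply measurable_fst] using this
  refine ⟨⟨m, hprob⟩, ⟨hm1, hm2⟩, ?_⟩
  have hE (p q : ℕ → ℝ≥0∞) : Measurable fun w => excess p q (T w) :=
    (measurable_of_countable (excess p q)).comp hT
  set f : V → ℝ≥0∞ := fun w => excess p q (T w)
  set g : V → ℝ≥0∞ := fun w => excess q p (T w)
  have hf : Measurable f := hE p q
  have hg : Measurable g := hE q p
  have hfi : ∫⁻ w, f w ∂(P : Measure V) = deficit p q :=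
    (lintegral_comp_nat _ hT _).trans (tsum_excess_mul hp)
  have hgi : ∫⁻ w, g w ∂(Q : Measure V) = deficit p q :=
    (lintegral_comp_nat _ hT _).trans ((tsum_excess_mul hq).trans (deficit_comm q p))
  -- Off the diagonal cells only the independent part of the density survives; there each summand of
  -- `D` factors over the two coordinates.
  have hpt (z : V × V) : G z * c z ≤ η * G z +
      ((D z.1 * f z.1) * (g z.2 * (deficit p q)⁻¹) +
        (f z.1 * (deficit p q)⁻¹) * (D z.2 * g z.2)) := by
    by_cases h : T z.1 = T z.2
    · refine le_add_right ?_
      rw [mul_comm]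
      gcongr
      exact hη _ _ h
    · refine le_add_left ?_
      have : G z = f z.1 * g z.2 * (deficit p q)⁻¹ := by
        simp [hG, overlapDensity, h, f, g]
      rw [this]
      calc f z.1 * g z.2 * (deficit p q)⁻¹ * c z
          ≤ f z.1 * g z.2 * (deficit p q)⁻¹ * (D z.1 + D z.2) := by
            gcongr; exact hcD _ _
        _ = _ := by ring
  calc ∫⁻ z, c z ∂m ≤ ∫⁻ z, G z * c z ∂((P : Measure V).prod Q) :=
        lintegral_withDensity_le_lintegral_mul _ hGm _
    _ ≤ ∫⁻ z, (η * G z + ((D z.1 * f z.1) * (g z.2 * (deficit p q)⁻¹) +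
        (f z.1 * (deficit p q)⁻¹) * (D z.2 * g z.2))) ∂((P : Measure V).prod Q) :=
        lintegral_mono hpt
    _ = η * 1 + ((∫⁻ w, D w * f w ∂(P : Measure V)) * (deficit p q * (deficit p q)⁻¹) +
        (deficit p q * (deficit p q)⁻¹) * ∫⁻ w, D w * g w ∂(Q : Measure V)) := by
        rw [lintegral_add_left (hGm.const_mul η), lintegral_add_left (by fun_prop),
          lintegral_const_mul _ hGm,
          lintegral_prod_mul (f := fun w => D w * f w) (g := fun w => g w * (deficit p q)⁻¹)
            (by fun_prop) (by fun_prop),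
          lintegral_prod_mul (f := fun w => f w * (deficit p q)⁻¹) (g := fun w => D w * g w)
            (by fun_prop) (by fun_prop),
          lintegral_mul_const _ hg, lintegral_mul_const _ hf, hfi, hgi,
          lintegral_prod _ hGm.aemeasurable, lintegral_congr_ae hfst]
        simp
    _ ≤ _ := by
        rw [mul_one]
        gcongr
        · exact mul_le_of_le_one_right' (deficit_mul_inv_le_one p q)
        · exact mul_le_of_le_one_left' (deficit_mul_inv_le_one p q)

end Overlap

/-! ### Compactness of the set of couplings in Wasserstein distance -/

section Compactness

/-- Tight marginals make the couplings tight, so Prokhorov's theorem applies; continuity of the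
projections preserves the marginals in the limit. -/
lemma exists_subseq_tendsto_of_mem_couplings {X Y : Type*}
    [MetricSpace X] [CompleteSpace X] [SecondCountableTopology X]
    [MeasurableSpace X] [BorelSpace X]
    [MetricSpace Y] [CompleteSpace Y] [SecondCountableTopology Y]
    [MeasurableSpace Y] [BorelSpace Y]
    {μ : ProbabilityMeasure X} {ν : ProbabilityMeasure Y} {π : ℕ → ProbabilityMeasure (X × Y)}
    (hπ : ∀ n, π n ∈ couplings μ ν) :
    ∃ φ : ℕ → ℕ, StrictMono φ ∧ ∃ π₀ ∈ couplings μ ν, Tendsto (π ∘ φ) atTop (𝓝 π₀) := by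
  have htight : IsTightMeasureSet
      {((ρ : ProbabilityMeasure (X × Y)) : Measure (X × Y)) | ρ ∈ couplings μ ν} := by
    refine IsTightMeasureSet.prodMk ?_ ?_
    · refine (isTightMeasureSet_singleton (μ := (μ : Measure X))).subset ?_
      rintro _ ⟨_, ⟨ρ, hρ, rfl⟩, rfl⟩
      exact hρ.1
    · refine (isTightMeasureSet_singleton (μ := (ν : Measure Y))).subset ?_
      rintro _ ⟨_, ⟨ρ, hρ, rfl⟩, rfl⟩
      exact hρ.2
  obtain ⟨π₀, -, φ, hφ, hlim⟩ := (isCompact_closure_of_isTightMeasureSet htight).tendsto_subseq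
    fun n => subset_closure (hπ n)
  refine ⟨φ, hφ, π₀, ⟨?_, ?_⟩, hlim⟩
  · have h1 := ProbabilityMeasure.tendsto_map_of_tendsto_of_continuous _ _ hlim
      (continuous_fst (X := X) (Y := Y))
    have h2 : Tendsto (fun n => ((π ∘ φ) n).map
        (continuous_fst (X := X) (Y := Y)).measurable.aemeasurable) atTop (𝓝 μ) :=
      tendsto_const_nhds.congr fun n => Subtype.ext (hπ _).1.symm
    exact congrArg ProbabilityMeasure.toMeasure (tendsto_nhds_unique h1 h2)
  · have h1 := ProbabilityMeasure.tendsto_map_of_tendsto_of_continuous _ _ hlim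
      (continuous_snd (X := X) (Y := Y))
    have h2 : Tendsto (fun n => ((π ∘ φ) n).map
        (continuous_snd (X := X) (Y := Y)).measurable.aemeasurable) atTop (𝓝 ν) :=
      tendsto_const_nhds.congr fun n => Subtype.ext (hπ _).2.symm
    exact congrArg ProbabilityMeasure.toMeasure (tendsto_nhds_unique h1 h2)

lemma measure_frontier_inter_eq_zero {V : Type*} [TopologicalSpace V] [MeasurableSpace V]
    {P : Measure V} {s t : Set V} (hs : P (frontier s) = 0) (ht : P (frontier t) = 0) :
    P (frontier (s ∩ t)) = 0 :=
  measure_mono_null ((frontier_inter_subset s t).trans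
    (union_subset_union inter_subset_left inter_subset_right)) (measure_union_null hs ht)

/-- The cells are successive differences of balls about a dense sequence. Radii above `δ / 2` make
the balls cover, radii below `δ` keep the cells small, and each radius is chosen so that the
frontier is null. -/
lemma exists_small_null_frontier_fibers {V : Type*} [MetricSpace V] [SecondCountableTopology V]
    [MeasurableSpace V] [BorelSpace V] (P : ProbabilityMeasure V) {ε : ℝ≥0∞} (hε : ε ≠ 0) :
    ∃ T : V → ℕ, Measurable T ∧ (∀ w w', T w = T w' → edist w w' ≤ ε) ∧
      ∀ k, (P : Measure V) (frontier (T ⁻¹' {k})) = 0 := by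
  classical
  have : Nonempty V := ⟨(nonempty_of_isProbabilityMeasure (P : Measure V)).some⟩
  obtain ⟨δ, hδ0, hδ⟩ : ∃ δ : ℝ, 0 < δ ∧ ENNReal.ofReal (2 * δ) ≤ ε := by
    obtain ⟨c, hc0, hc⟩ := ENNReal.lt_iff_exists_nnreal_btwn.1 (pos_iff_ne_zero.2 hε)
    refine ⟨c / 2, by have : 0 < c := by exact_mod_cast hc0
                      positivity, ?_⟩
    rw [mul_div_cancel₀ _ two_ne_zero, ENNReal.ofReal_coe_nnreal]
    exact hc.le
  have hrad (x : V) : ∃ ρ ∈ Ioo (δ / 2) δ, (P : Measure V) (frontier (Metric.ball x ρ)) = 0 := by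
    obtain ⟨ρ, hρ, h0⟩ := exists_null_frontier_thickening (P : Measure V) {x} (half_lt_self hδ0)
    exact ⟨ρ, hρ, by rwa [Metric.thickening_singleton] at h0⟩
  choose ρ hρ hρ0 using hrad
  set u := TopologicalSpace.denseSeq V
  set B : ℕ → Set V := fun k => Metric.ball (u k) (ρ (u k))
  have hcov (w : V) : ∃ k, w ∈ B k := by
    obtain ⟨k, hk⟩ := (TopologicalSpace.denseRange_denseSeq V).exists_dist_lt w (half_pos hδ0)
    exact ⟨k, hk.trans (hρ _).1⟩
  have hfib (k : ℕ) : (fun w => Nat.find (hcov w)) ⁻¹' {k} = B k ∩ {w | ∀ j < k, w ∉ B j} := by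
    ext w
    simp [Nat.find_eq_iff]
  have hrest (k : ℕ) : {w | ∀ j < k + 1, w ∉ B j} = {w | ∀ j < k, w ∉ B j} ∩ (B k)ᶜ := by
    ext w
    exact Nat.forall_lt_succ_right
  have hrest_meas (k : ℕ) : MeasurableSet {w | ∀ j < k, w ∉ B j} := by
    induction k with
    | zero => simp
    | succ k ih => rw [hrest]; exact ih.inter Metric.isOpen_ball.measurableSet.compl
  have hrest_null (k : ℕ) : (P : Measure V) (frontier {w | ∀ j < k, w ∉ B j}) = 0 := by
    induction k with
    | zero => simp
    | succ k ih =>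
      rw [hrest]
      exact measure_frontier_inter_eq_zero ih (by rw [frontier_compl]; exact hρ0 _)
  refine ⟨fun w => Nat.find (hcov w), ?_, fun w w' h => ?_, fun k => ?_⟩
  · refine measurable_to_countable' fun k => ?_
    rw [hfib]
    exact Metric.isOpen_ball.measurableSet.inter (hrest_meas k)
  · have h1 : dist w (u (Nat.find (hcov w))) < ρ _ := Nat.find_spec (hcov w)
    have h2 : dist w' (u (Nat.find (hcov w'))) < ρ _ := Nat.find_spec (hcov w')
    simp only at h
    rw [← h] at h2
    rw [edist_dist]
    refine (ENNReal.ofReal_le_ofReal ?_).trans hδ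
    have h3 := dist_triangle_right w w' (u (Nat.find (hcov w)))
    have h4 := (hρ (u (Nat.find (hcov w)))).2
    linarith
  · rw [hfib]
    exact measure_frontier_inter_eq_zero (hρ0 _) (hrest_null k)

/-- A discrete Scheffé lemma: the unshared mass at each cell is dominated by the summable `q`. -/
lemma tendsto_deficit_of_tendsto {q : ℕ → ℝ≥0∞} (hq : ∑' k, q k = 1) {p : ℕ → ℕ → ℝ≥0∞}
    (hp : ∀ k, Tendsto (fun n => p n k) atTop (𝓝 (q k))) :
    Tendsto (fun n => deficit q (p n)) atTop (𝓝 0) := by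
  have hsum (n : ℕ) : deficit q (p n) =
      ∫⁻ k, excess q (p n) k * q k ∂(Measure.count : Measure ℕ) := by
    rw [lintegral_count, tsum_excess_mul hq]
  simp only [hsum]
  have := tendsto_lintegral_of_dominated_convergence (μ := (Measure.count : Measure ℕ)) q
    (F := fun n k => excess q (p n) k * q k) (f := fun _ => 0)
    (fun n => measurable_of_countable _)
    (fun n => Eventually.of_forall fun k => mul_le_of_le_one_left' (excess_le_one _ _ _))
    (by rw [lintegral_count, hq]; exact ENNReal.one_ne_top) ?_
  · simpa using this
  · refine Eventually.of_forall fun k => ?_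
    have hk := ne_top_of_tsum_eq_one hq k
    by_cases h0 : q k = 0
    · simp [h0]
    have h1 : Tendsto (fun n => min (q k) (p n k)) atTop (𝓝 (q k)) := by
      simpa using (tendsto_const_nhds (x := q k)).min (hp k)
    have h2 : Tendsto (fun n => min (q k) (p n k) / q k) atTop (𝓝 1) := by
      have := ENNReal.Tendsto.div_const h1 (Or.inr h0)
      rwa [ENNReal.div_self h0 hk] at this
    have h3 : Tendsto (fun n => excess q (p n) k) atTop (𝓝 0) := by
      have := ENNReal.Tendsto.sub (tendsto_const_nhds (x := (1 : ℝ≥0∞))) h2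
        (Or.inl ENNReal.one_ne_top)
      simpa [excess] using this
    simpa using ENNReal.Tendsto.mul_const h3 (Or.inr hk)

/-- Since `f ∘ g` has the same law under every `P n`, it is uniformly integrable: the part of `f`
above a level `R` is small uniformly in `n`, and the part below is controlled by `R` times the
integral of `h n`. -/
lemma tendsto_lintegral_mul_of_map_eq {V X : Type*} [MeasurableSpace V] [MeasurableSpace X]
    {μ : Measure X} {P : ℕ → Measure V} {g : V → X} (hg : Measurable g)
    (hP : ∀ n, (P n).map g = μ) {f : X → ℝ≥0∞} (hf : Measurable f) (hfi : ∫⁻ x, f x ∂μ ≠ ∞)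
    {h : ℕ → V → ℝ≥0∞} (hm : ∀ n, Measurable (h n)) (h1 : ∀ n w, h n w ≤ 1)
    (hlim : Tendsto (fun n => ∫⁻ w, h n w ∂(P n)) atTop (𝓝 0)) :
    Tendsto (fun n => ∫⁻ w, f (g w) * h n w ∂(P n)) atTop (𝓝 0) := by
  have htail : Tendsto (fun R : ℕ => ∫⁻ x, (f x - R) ∂μ) atTop (𝓝 0) := by
    have := tendsto_lintegral_of_dominated_convergence (μ := μ) f
      (F := fun (R : ℕ) x => f x - R) (f := fun _ => 0)
      (fun R => hf.sub measurable_const) (fun R => Eventually.of_forall fun x => tsub_le_self)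
      hfi ?_
    · simpa using this
    · filter_upwards [ae_lt_top hf hfi] with x hx
      obtain ⟨N, hN⟩ := ENNReal.exists_nat_gt hx.ne
      refine tendsto_const_nhds.congr' ?_
      filter_upwards [eventually_ge_atTop N] with R hR
      exact (tsub_eq_zero_of_le (hN.le.trans (by exact_mod_cast hR))).symm
  have hbound (R n : ℕ) : ∫⁻ w, f (g w) * h n w ∂(P n) ≤
      R * ∫⁻ w, h n w ∂(P n) + ∫⁻ x, (f x - R) ∂μ := by
    calc ∫⁻ w, f (g w) * h n w ∂(P n) ≤ ∫⁻ w, (R * h n w + (f (g w) - R)) ∂(P n) := by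
          refine lintegral_mono fun w => ?_
          calc f (g w) * h n w ≤ (R + (f (g w) - R)) * h n w := by
                gcongr; exact le_add_tsub
            _ = R * h n w + (f (g w) - R) * h n w := add_mul _ _ _
            _ ≤ _ := by gcongr; exact mul_le_of_le_one_right' (h1 n w)
      _ = R * ∫⁻ w, h n w ∂(P n) + ∫⁻ x, (f x - R) ∂μ := by
          have hfR : Measurable fun x => f x - (R : ℝ≥0∞) := hf.sub measurable_const
          rw [lintegral_add_left ((hm n).const_mul _), lintegral_const_mul _ (hm n), ← hP n,
            lintegral_map hfR hg]
  refine ENNReal.tendsto_nhds_zero.2 fun ε hε => ?_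
  have hε2 : 0 < ε / 2 := ENNReal.half_pos hε.ne'
  obtain ⟨R, hR⟩ := (ENNReal.tendsto_nhds_zero.1 htail _ hε2).exists
  have hlimR : Tendsto (fun n => (R : ℝ≥0∞) * ∫⁻ w, h n w ∂(P n)) atTop (𝓝 0) := by
    simpa using ENNReal.Tendsto.const_mul hlim (Or.inr (ENNReal.natCast_ne_top R))
  filter_upwards [ENNReal.tendsto_nhds_zero.1 hlimR _ hε2] with n hn
  calc _ ≤ _ := hbound R n
    _ ≤ ε / 2 + ε / 2 := add_le_add hn hR
    _ = ε := ENNReal.add_halves ε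

/-- Weak convergence gives convergence of the masses of cells with null frontier, hence vanishing
deficit. The dominating cost `D` is a sum of functions of one coordinate each, so the fixed
marginals control its integral over the unshared mass. -/
lemma tendsto_wasserstein_of_tendsto {X Y : Type*}
    [MetricSpace X] [SecondCountableTopology X] [MeasurableSpace X] [BorelSpace X]
    [MetricSpace Y] [SecondCountableTopology Y] [MeasurableSpace Y] [BorelSpace Y]
    {r : ℝ} (hr : 0 < r) {μ : ProbabilityMeasure X} {ν : ProbabilityMeasure Y}
    (hμ : HasFiniteMoment r μ) (hν : HasFiniteMoment r ν)
    {π : ℕ → ProbabilityMeasure (X × Y)} (hπ : ∀ n, π n ∈ couplings μ ν)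
    {π₀ : ProbabilityMeasure (X × Y)} (hπ₀ : π₀ ∈ couplings μ ν)
    (hlim : Tendsto π atTop (𝓝 π₀)) :
    Tendsto (fun n => wasserstein r (π n) π₀) atTop (𝓝 0) := by
  obtain ⟨x₀, hx₀⟩ := hμ
  obtain ⟨y₀, hy₀⟩ := hν
  have h2r : (2 : ℝ≥0∞) ^ r ≠ ∞ := ENNReal.rpow_ne_top_of_nonneg hr.le ENNReal.ofNat_ne_top
  set fX : X → ℝ≥0∞ := fun x => 2 ^ r * edist x₀ x ^ r with hfX
  set fY : Y → ℝ≥0∞ := fun y => 2 ^ r * edist y₀ y ^ r with hfY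
  have hfXm : Measurable fX := (((measurable_const).edist measurable_id).pow_const r).const_mul _
  have hfYm : Measurable fY := (((measurable_const).edist measurable_id).pow_const r).const_mul _
  have hfXi : ∫⁻ x, fX x ∂(μ : Measure X) ≠ ∞ := by
    rw [lintegral_const_mul' _ _ h2r]; exact ENNReal.mul_ne_top h2r hx₀.ne
  have hfYi : ∫⁻ y, fY y ∂(ν : Measure Y) ≠ ∞ := by
    rw [lintegral_const_mul' _ _ h2r]; exact ENNReal.mul_ne_top h2r hy₀.ne
  set D : X × Y → ℝ≥0∞ := fun w => fX w.1 + fY w.2 with hDdef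
  have hD : Measurable D := (hfXm.comp measurable_fst).add (hfYm.comp measurable_snd)
  have hcD (w w' : X × Y) : edist w w' ^ r ≤ D w + D w' := by
    refine (edist_rpow_le_two_rpow_mul_add hr.le w (x₀, y₀) w').trans ?_
    rw [edist_comm w, mul_add]
    have key (v : X × Y) : 2 ^ r * edist (x₀, y₀) v ^ r ≤ D v := by
      rw [hDdef]
      simp only [hfX, hfY]
      rw [← mul_add]
      gcongr
      exact edist_prod_rpow_le _ _
    exact add_le_add (key w) (key w')
  have hDlim (P : ℕ → ProbabilityMeasure (X × Y)) (hP : ∀ n, P n ∈ couplings μ ν)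
      (h : ℕ → X × Y → ℝ≥0∞) (hm : ∀ n, Measurable (h n)) (h1 : ∀ n w, h n w ≤ 1)
      (h0 : Tendsto (fun n => ∫⁻ w, h n w ∂(P n : Measure (X × Y))) atTop (𝓝 0)) :
      Tendsto (fun n => ∫⁻ w, D w * h n w ∂(P n : Measure (X × Y))) atTop (𝓝 0) := by
    have hX := tendsto_lintegral_mul_of_map_eq measurable_fst (fun n => (hP n).1) hfXm hfXi hm h1 h0
    have hY := tendsto_lintegral_mul_of_map_eq measurable_snd (fun n => (hP n).2) hfYm hfYi hm h1 h0
    have := hX.add hY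
    rw [add_zero] at this
    refine this.congr fun n => ?_
    have hfXh : Measurable fun w : X × Y => fX w.1 * h n w :=
      (hfXm.comp measurable_fst).mul (hm n)
    rw [← lintegral_add_left hfXh]
    simp only [hDdef, add_mul]
  have hI : Tendsto (fun n => ⨅ m ∈ couplings (π n) π₀,
      ∫⁻ p, edist p.1 p.2 ^ r ∂(m : Measure ((X × Y) × (X × Y)))) atTop (𝓝 0) := by
    refine ENNReal.tendsto_nhds_zero.2 fun ε hε => ?_
    have hε2 : 0 < ε / 2 := ENNReal.half_pos hε.ne'
    -- Cells of this diameter make the cost within a cell at most `ε / 2`.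
    have hη : (ε / 2) ^ (1 / r) ≠ 0 := by
      simp [ENNReal.rpow_eq_zero_iff, hε.ne', hr, not_lt.2 hr.le]
    obtain ⟨T, hT, hTd, hT0⟩ := exists_small_null_frontier_fibers π₀ hη
    set q : ℕ → ℝ≥0∞ := fun k => (π₀ : Measure (X × Y)) (T ⁻¹' {k})
    set p : ℕ → ℕ → ℝ≥0∞ := fun n k => (π n : Measure (X × Y)) (T ⁻¹' {k})
    have hq : ∑' k, q k = 1 := tsum_measure_fiber _ hT
    have hp (n : ℕ) : ∑' k, p n k = 1 := tsum_measure_fiber _ hT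
    have hdef : Tendsto (fun n => deficit q (p n)) atTop (𝓝 0) :=
      tendsto_deficit_of_tendsto hq fun k =>
        ProbabilityMeasure.tendsto_measure_of_null_frontier_of_tendsto' hlim (hT0 k)
    have hE (p q : ℕ → ℝ≥0∞) : Measurable fun w => excess p q (T w) :=
      (measurable_of_countable (excess p q)).comp hT
    have hA := hDlim π hπ (fun n w => excess (p n) q (T w)) (fun n => hE _ _)
      (fun n w => excess_le_one _ _ _) (hdef.congr fun n =>
        (deficit_comm _ _).trans ((lintegral_comp_nat _ hT _).trans (tsum_excess_mul (hp n))).symm)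
    have hB := hDlim (fun _ => π₀) (fun _ => hπ₀) (fun n w => excess q (p n) (T w))
      (fun n => hE _ _) (fun n w => excess_le_one _ _ _) (hdef.congr fun n =>
        ((lintegral_comp_nat _ hT _).trans (tsum_excess_mul hq)).symm)
    have hAB := hA.add hB
    rw [add_zero] at hAB
    filter_upwards [ENNReal.tendsto_nhds_zero.1 hAB _ hε2] with n hn
    have hcell (w w' : X × Y) (h : T w = T w') : edist w w' ^ r ≤ ε / 2 :=
      calc edist w w' ^ r ≤ ((ε / 2) ^ (1 / r)) ^ r := ENNReal.rpow_le_rpow (hTd _ _ h) hr.le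
        _ = ε / 2 := by
          rw [← ENNReal.rpow_mul, one_div, inv_mul_cancel₀ hr.ne', ENNReal.rpow_one]
    obtain ⟨m, hm, hle⟩ := exists_overlap_coupling (π n) π₀ hT
      (c := fun z => edist z.1 z.2 ^ r) hD hcell hcD
    refine (iInf₂_le m hm).trans (hle.trans ?_)
    calc _ ≤ ε / 2 + ε / 2 := by gcongr
      _ = ε := ENNReal.add_halves ε
  have hr' : 0 < 1 / r := by positivity
  have := (ENNReal.continuous_rpow_const (y := 1 / r)).tendsto 0 |>.comp hI
  rwa [ENNReal.zero_rpow_of_pos hr'] at this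

end Compactness

/-! ### Stability of feasible sets and risks -/

section Stability

lemma maxSpectralRisk_ne_bot_and_ne_top {X Y : Type*} [MeasurableSpace X]
    [MeasurableSpace Y] {μ : ProbabilityMeasure X} {ν : ProbabilityMeasure Y}
    {σ : ℝ → ℝ} {f : X × Y → ℝ} {B : ℝ≥0∞} (hB : B ≠ ∞)
    (h : ∀ π ∈ couplings μ ν, ∀ π' ∈ couplings μ ν,
      edist (spectralRisk σ π f) (spectralRisk σ π' f) ≤ B) :
    maxSpectralRisk σ f μ ν ≠ ⊥ ∧ maxSpectralRisk σ f μ ν ≠ ⊤ := by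
  have h0 := prod_mem_couplings μ ν
  constructor
  · refine ne_bot_of_le_ne_bot (EReal.coe_ne_bot (spectralRisk σ (μ.prod ν) f)) ?_
    exact le_iSup₂ (f := fun π (_ : π ∈ couplings μ ν) => (spectralRisk σ π f : EReal)) _ h0
  · refine ne_top_of_le_ne_top (EReal.coe_ne_top (spectralRisk σ (μ.prod ν) f + B.toReal)) ?_
    refine iSup₂_le fun π hπ => EReal.coe_le_coe_iff.2 ?_
    have h1 := ENNReal.toReal_mono hB (h π hπ _ h0)
    rw [← dist_edist, Real.dist_eq] at h1
    linarith [le_abs_self (spectralRisk σ π f - spectralRisk σ (μ.prod ν) f)]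

variable {X Y : Type*}
  [MetricSpace X] [SecondCountableTopology X] [MeasurableSpace X] [BorelSpace X]
  [MetricSpace Y] [SecondCountableTopology Y] [MeasurableSpace Y] [BorelSpace Y]

/-- Each `πn n` is transported to a nearby element of `Π(μ, ν)`, compactness is applied there, and
the two transports are composed. -/
lemma exists_subseq_tendsto_wasserstein [CompleteSpace X] [CompleteSpace Y] {r : ℝ} (hr : 0 < r)
    {μ : ProbabilityMeasure X} {ν : ProbabilityMeasure Y}
    {μn : ℕ → ProbabilityMeasure X} {νn : ℕ → ProbabilityMeasure Y}
    (hμ : HasFiniteMoment r μ) (hν : HasFiniteMoment r ν)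
    (hWμ : Tendsto (fun n => wasserstein r (μn n) μ) atTop (𝓝 0))
    (hWν : Tendsto (fun n => wasserstein r (νn n) ν) atTop (𝓝 0))
    {πn : ℕ → ProbabilityMeasure (X × Y)} (hπn : ∀ n, πn n ∈ couplings (μn n) (νn n)) :
    ∃ φ : ℕ → ℕ, StrictMono φ ∧ ∃ π ∈ couplings μ ν,
      Tendsto (fun k => wasserstein r (πn (φ k)) π) atTop (𝓝 0) := by
  obtain ⟨a, ha, ha0⟩ := exists_couplings_tendsto_of_tendsto_wasserstein hr hWμ
  obtain ⟨b, hb, hb0⟩ := exists_couplings_tendsto_of_tendsto_wasserstein hr hWν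
  choose ρ hρ m hm hle using fun n =>
    exists_coupling_of_marginal_couplings (r := r) (hπn n) (ha n) (hb n)
  have hab := ha0.add hb0
  rw [add_zero] at hab
  have hm0 := tendsto_of_tendsto_of_tendsto_of_le_of_le tendsto_const_nhds hab
    (fun _ => zero_le) hle
  obtain ⟨φ, hφ, π, hπ, hlim⟩ := exists_subseq_tendsto_of_mem_couplings hρ
  obtain ⟨m', hm', hm0'⟩ := exists_couplings_tendsto_of_tendsto_wasserstein hr
    (tendsto_wasserstein_of_tendsto hr hμ hν (fun n => hρ (φ n)) hπ hlim)
  choose N hN hNle using fun k =>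
    exists_coupling_cost_le_of_couplings hr.le (hm (φ k)) (hm' k)
  refine ⟨φ, hφ, π, hπ, tendsto_wasserstein_of_couplings hr hN ?_⟩
  refine tendsto_of_tendsto_of_tendsto_of_le_of_le tendsto_const_nhds ?_ (fun _ => zero_le) hNle
  have hsum := (hm0.comp hφ.tendsto_atTop).add hm0'
  have := ENNReal.Tendsto.const_mul hsum (a := 2 ^ r)
    (Or.inr (ENNReal.rpow_ne_top_of_nonneg hr.le ENNReal.ofNat_ne_top))
  rw [add_zero, mul_zero] at this
  exact this

lemma exists_couplings_tendsto_wasserstein [CompleteSpace X] [CompleteSpace Y]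
    {r : ℝ} (hr : 0 < r)
    {μ : ProbabilityMeasure X} {ν : ProbabilityMeasure Y}
    {μn : ℕ → ProbabilityMeasure X} {νn : ℕ → ProbabilityMeasure Y}
    (hWμ : Tendsto (fun n => wasserstein r (μn n) μ) atTop (𝓝 0))
    (hWν : Tendsto (fun n => wasserstein r (νn n) ν) atTop (𝓝 0))
    {π : ProbabilityMeasure (X × Y)} (hπ : π ∈ couplings μ ν) :
    ∃ πn : ℕ → ProbabilityMeasure (X × Y), (∀ n, πn n ∈ couplings (μn n) (νn n)) ∧
      Tendsto (fun n => wasserstein r (πn n) π) atTop (𝓝 0) := by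
  obtain ⟨a, ha, ha0⟩ := exists_couplings_tendsto_of_tendsto_wasserstein hr hWμ
  obtain ⟨b, hb, hb0⟩ := exists_couplings_tendsto_of_tendsto_wasserstein hr hWν
  choose ρ hρ m hm hle using fun n => exists_coupling_of_marginal_couplings (r := r) hπ
    (swap_mem_couplings (ha n)) (swap_mem_couplings (hb n))
  refine ⟨ρ, hρ, tendsto_wasserstein_of_couplings hr (fun n => swap_mem_couplings (hm n)) ?_⟩
  simp only [lintegral_edist_rpow_pushforward_swap] at hle ⊢
  have hab := ha0.add hb0
  rw [add_zero] at hab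
  exact tendsto_of_tendsto_of_tendsto_of_le_of_le tendsto_const_nhds hab (fun _ => zero_le) hle

lemma lintegral_edist_le_of_holderWith {V : Type*} [MetricSpace V] [SecondCountableTopology V]
    [MeasurableSpace V] [BorelSpace V] (m : ProbabilityMeasure (V × V)) {f : V → ℝ}
    {C q : ℝ≥0} (hf : HolderWith C q f) (hq : 0 < q) {r : ℝ} (hqr : q ≤ r) :
    ∫⁻ p, edist (f p.1) (f p.2) ∂(m : Measure (V × V)) ≤
      C * (∫⁻ p, edist p.1 p.2 ^ r ∂(m : Measure (V × V))) ^ ((q : ℝ) / r) := by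
  have hq' : (0 : ℝ) < q := hq
  have hmeas : Measurable fun p : V × V => edist p.1 p.2 := measurable_fst.edist measurable_snd
  calc ∫⁻ p, edist (f p.1) (f p.2) ∂(m : Measure (V × V))
      ≤ ∫⁻ p, C * edist p.1 p.2 ^ (q : ℝ) ∂(m : Measure (V × V)) :=
        lintegral_mono fun p => hf p.1 p.2
    _ = C * ∫⁻ p, edist p.1 p.2 ^ (q : ℝ) ∂(m : Measure (V × V)) :=
        lintegral_const_mul' _ _ ENNReal.coe_ne_top
    _ ≤ _ := by
        gcongr
        -- Monotonicity of `L^p` norms in the exponent, valid since `m` has mass one.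
        have h := eLpNorm'_le_eLpNorm'_of_exponent_le hq' hqr (m : Measure (V × V))
          hmeas.aestronglyMeasurable
        simp only [eLpNorm', enorm_eq_self] at h
        have h' := ENNReal.rpow_le_rpow h hq'.le
        rwa [← ENNReal.rpow_mul, ← ENNReal.rpow_mul, one_div, inv_mul_cancel₀ hq'.ne',
          ENNReal.rpow_one, one_div, inv_mul_eq_div] at h'

lemma edist_spectralRisk_le_of_holderWith {V : Type*} [MetricSpace V] [SecondCountableTopology V]
    [MeasurableSpace V] [BorelSpace V] {π π' : ProbabilityMeasure V}
    {m : ProbabilityMeasure (V × V)} (hm : m ∈ couplings π π') {f : V → ℝ}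
    {C q : ℝ≥0} (hf : HolderWith C q f) (hq : 0 < q) {r : ℝ} (hqr : q ≤ r)
    (hi : Integrable f (π : Measure V)) (hi' : Integrable f (π' : Measure V))
    {σ : ℝ → ℝ} (hσ : IsSpectralFunction σ) {M : ℝ≥0} (hM : ∀ u ∈ Ioo (0 : ℝ) 1, ‖σ u‖ₑ ≤ M) :
    edist (spectralRisk σ π f) (spectralRisk σ π' f) ≤
      M * (C * (∫⁻ p, edist p.1 p.2 ^ r ∂(m : Measure (V × V))) ^ ((q : ℝ) / r)) := by
  have hfm : Measurable f := (hf.continuous hq).measurable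
  refine (edist_spectralRisk_le_of_mem_couplings hm hfm hfm hi hi' hσ hM).trans ?_
  gcongr
  exact lintegral_edist_le_of_holderWith m hf hq hqr

/-- The product coupling of `π` and `π'` has cost bounded by the marginal moments. The bound `B` is
independent of `f`, so it survives the passage from `Ln` to the limit loss. -/
lemma exists_bound_edist_spectralRisk {r : ℝ} (hr : 0 < r)
    {μ : ProbabilityMeasure X} {ν : ProbabilityMeasure Y}
    (hμ : HasFiniteMoment r μ) (hν : HasFiniteMoment r ν)
    {σ : ℝ → ℝ} (hσ : IsSpectralFunction σ) (C : ℝ≥0) {q : ℝ≥0} (hq : 0 < q) (hqr : q ≤ r) :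
    ∃ B : ℝ≥0∞, B ≠ ∞ ∧ ∀ f : X × Y → ℝ, HolderWith C q f →
      (∀ π ∈ couplings μ ν, Integrable f (π : Measure (X × Y))) →
      ∀ π ∈ couplings μ ν, ∀ π' ∈ couplings μ ν,
        edist (spectralRisk σ π f) (spectralRisk σ π' f) ≤ B := by
  obtain ⟨x₀, hx₀⟩ := hμ
  obtain ⟨y₀, hy₀⟩ := hν
  obtain ⟨M, hM⟩ := hσ.exists_bound
  have h2r : (2 : ℝ≥0∞) ^ r ≠ ∞ := ENNReal.rpow_ne_top_of_nonneg hr.le ENNReal.ofNat_ne_top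
  set S : ℝ≥0∞ := ∫⁻ x, edist x₀ x ^ r ∂(μ : Measure X) + ∫⁻ y, edist y₀ y ^ r ∂(ν : Measure Y)
  have hS : S ≠ ∞ := ENNReal.add_ne_top.2 ⟨hx₀.ne, hy₀.ne⟩
  have hmom (π : ProbabilityMeasure (X × Y)) (hπ : π ∈ couplings μ ν) :
      ∫⁻ w, edist (x₀, y₀) w ^ r ∂(π : Measure (X × Y)) ≤ S := by
    have hX : Measurable fun x : X => edist x₀ x ^ r :=
      (measurable_const.edist measurable_id).pow_const r
    have hY : Measurable fun y : Y => edist y₀ y ^ r :=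
      (measurable_const.edist measurable_id).pow_const r
    have hX' : Measurable fun w : X × Y => edist x₀ w.1 ^ r := hX.comp measurable_fst
    simp only [S]
    rw [← hπ.1, ← hπ.2, lintegral_map hX measurable_fst, lintegral_map hY measurable_snd,
      ← lintegral_add_left hX']
    exact lintegral_mono fun w => edist_prod_rpow_le _ _
  refine ⟨M * (C * (2 ^ r * (S + S)) ^ ((q : ℝ) / r)), ?_, fun f hf hfi π hπ π' hπ' => ?_⟩
  · refine ENNReal.mul_ne_top ENNReal.coe_ne_top (ENNReal.mul_ne_top ENNReal.coe_ne_top ?_)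
    refine ENNReal.rpow_ne_top_of_nonneg (by positivity) (ENNReal.mul_ne_top h2r ?_)
    exact ENNReal.add_ne_top.2 ⟨hS, hS⟩
  · have hprod := prod_mem_couplings π π'
    refine (edist_spectralRisk_le_of_holderWith hprod hf hq hqr (hfi π hπ) (hfi π' hπ') hσ hM).trans
      ?_
    gcongr
    have hW : Measurable fun w : X × Y => edist (x₀, y₀) w ^ r :=
      (measurable_const.edist measurable_id).pow_const r
    have hW1 : Measurable fun p : (X × Y) × (X × Y) => edist (x₀, y₀) p.1 ^ r :=
      hW.comp measurable_fst
    calc ∫⁻ p, edist p.1 p.2 ^ r ∂(π.prod π' : Measure ((X × Y) × (X × Y)))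
        ≤ ∫⁻ p, 2 ^ r * (edist (x₀, y₀) p.1 ^ r + edist (x₀, y₀) p.2 ^ r)
            ∂(π.prod π' : Measure ((X × Y) × (X × Y))) := by
          refine lintegral_mono fun p => ?_
          rw [edist_comm (x₀, y₀) p.1]
          exact edist_rpow_le_two_rpow_mul_add hr.le _ _ _
      _ = 2 ^ r * (∫⁻ w, edist (x₀, y₀) w ^ r ∂(π : Measure (X × Y)) +
            ∫⁻ w, edist (x₀, y₀) w ^ r ∂(π' : Measure (X × Y))) := by
          rw [lintegral_const_mul' _ _ h2r, lintegral_add_left hW1,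
            ← lintegral_map hW measurable_fst, ← lintegral_map hW measurable_snd, hprod.1, hprod.2]
      _ ≤ _ := by
          gcongr
          · exact hmom π hπ
          · exact hmom π' hπ'

/-- Continuity of the spectral risk along couplings converging in Wasserstein distance and
uniformly Hölder losses converging in `L¹` of the limit coupling. -/
lemma tendsto_spectralRisk {V : Type*} [MetricSpace V] [SecondCountableTopology V]
    [MeasurableSpace V] [BorelSpace V] {r : ℝ} (hr : 0 < r) {πn : ℕ → ProbabilityMeasure V}
    {π : ProbabilityMeasure V} (hW : Tendsto (fun n => wasserstein r (πn n) π) atTop (𝓝 0))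
    {Ln : ℕ → V → ℝ} {L : V → ℝ} (hL : Measurable L) {C q : ℝ≥0} (hq : 0 < q) (hqr : q ≤ r)
    (hHolder : ∀ n, HolderWith C q (Ln n)) (hn : ∀ n, Integrable (Ln n) (πn n : Measure V))
    (hi : ∀ n, Integrable (Ln n) (π : Measure V)) (hLi : Integrable L (π : Measure V))
    (hlim : Tendsto (fun n => eLpNorm (Ln n - L) 1 (π : Measure V)) atTop (𝓝 0))
    {σ : ℝ → ℝ} (hσ : IsSpectralFunction σ) :
    Tendsto (fun n => spectralRisk σ (πn n) (Ln n)) atTop (𝓝 (spectralRisk σ π L)) := by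
  obtain ⟨M, hM⟩ := hσ.exists_bound
  obtain ⟨m, hm, hm0⟩ := exists_couplings_tendsto_of_tendsto_wasserstein hr hW
  have hbound (n : ℕ) : edist (spectralRisk σ (πn n) (Ln n)) (spectralRisk σ π L) ≤
      M * (C * (∫⁻ p, edist p.1 p.2 ^ r ∂(m n : Measure (V × V))) ^ ((q : ℝ) / r)) +
        M * eLpNorm (Ln n - L) 1 (π : Measure V) := by
    -- First change the measure with the Hölder loss fixed, then change the loss under the fixed
    -- measure `π`.
    refine (edist_triangle _ (spectralRisk σ π (Ln n)) _).trans (add_le_add ?_ ?_)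
    · exact edist_spectralRisk_le_of_holderWith (hm n) (hHolder n) hq hqr (hn n) (hi n) hσ hM
    · rw [eLpNorm_one_eq_lintegral_enorm]
      simp only [Pi.sub_apply, ← edist_eq_enorm_sub]
      exact edist_spectralRisk_le π ((hHolder n).continuous hq).measurable hL (hi n) hLi hσ hM
  rw [tendsto_iff_edist_tendsto_0]
  refine tendsto_of_tendsto_of_tendsto_of_le_of_le tendsto_const_nhds ?_ (fun _ => zero_le) hbound
  have hqr' : 0 < (q : ℝ) / r := div_pos hq hr
  have h1 := (ENNReal.continuous_rpow_const (y := (q : ℝ) / r)).tendsto 0 |>.comp hm0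
  rw [ENNReal.zero_rpow_of_pos hqr'] at h1
  have h2 := ENNReal.Tendsto.const_mul (ENNReal.Tendsto.const_mul h1
    (Or.inr (ENNReal.coe_ne_top (r := C)))) (Or.inr (ENNReal.coe_ne_top (r := M)))
  have h3 := ENNReal.Tendsto.const_mul hlim (Or.inr (ENNReal.coe_ne_top (r := M)))
  have h4 := h2.add h3
  simp only [mul_zero, add_zero] at h4
  exact h4

lemma wasserstein_self {V : Type*} [MetricSpace V] [SecondCountableTopology V]
    [MeasurableSpace V] [BorelSpace V] {r : ℝ} (hr : 0 < r) (π : ProbabilityMeasure V) :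
    wasserstein r π π = 0 := by
  have hd : Measurable fun v : V => (v, v) := measurable_id.prodMk measurable_id
  have hmem : pushforward π hd ∈ couplings π π := by
    constructor
    · rw [coe_pushforward, Measure.map_map measurable_fst hd]; exact Measure.map_id
    · rw [coe_pushforward, Measure.map_map measurable_snd hd]; exact Measure.map_id
  have h0 : ∫⁻ p, edist p.1 p.2 ^ r ∂(pushforward π hd : Measure (V × V)) = 0 := by
    rw [coe_pushforward, lintegral_map ((measurable_fst.edist measurable_snd).pow_const r) hd]
    simp [ENNReal.zero_rpow_of_pos hr]
  have hle := iInf₂_le (f := fun m (_ : m ∈ couplings π π) =>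
    ∫⁻ p, edist p.1 p.2 ^ r ∂(m : Measure (V × V))) _ hmem
  rw [h0, nonpos_iff_eq_zero] at hle
  rw [wasserstein, hle, ENNReal.zero_rpow_of_pos (by positivity)]

end Stability

end SpectralRisk

/-! ### The stability theorem -/

theorem mainTheorem5
    {X Y : Type*}
    [MetricSpace X] [CompleteSpace X] [TopologicalSpace.SeparableSpace X]
    [MeasurableSpace X] [BorelSpace X]
    [MetricSpace Y] [CompleteSpace Y] [TopologicalSpace.SeparableSpace Y]
    [MeasurableSpace Y] [BorelSpace Y]
    (σ : ℝ → ℝ) (hσ : SpectralRisk.IsSpectralFunction σ)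
    (r : ℝ) (hr : 1 ≤ r)
    (μ : ProbabilityMeasure X) (ν : ProbabilityMeasure Y)
    (μn : ℕ → ProbabilityMeasure X) (νn : ℕ → ProbabilityMeasure Y)
    (hμ : SpectralRisk.HasFiniteMoment r μ) (hν : SpectralRisk.HasFiniteMoment r ν)
    (hμn : ∀ n, SpectralRisk.HasFiniteMoment r (μn n))
    (hνn : ∀ n, SpectralRisk.HasFiniteMoment r (νn n))
    (hWμ : Tendsto (fun n => SpectralRisk.wasserstein r (μn n) μ) atTop (𝓝 0))
    (hWν : Tendsto (fun n => SpectralRisk.wasserstein r (νn n) ν) atTop (𝓝 0))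
    (L : X × Y → ℝ) (hL : Measurable L)
    (Ln : ℕ → X × Y → ℝ)
    (C q : ℝ≥0) (hq0 : 0 < q) (hq1 : q ≤ 1)
    (hHolder : ∀ n, HolderWith C q (Ln n))
    (hLn_int_n : ∀ n, ∀ π ∈ SpectralRisk.couplings (μn n) (νn n),
      Integrable (Ln n) (π : Measure (X × Y)))
    (hLn_int : ∀ n, ∀ π ∈ SpectralRisk.couplings μ ν,
      Integrable (Ln n) (π : Measure (X × Y)))
    (hLn_tendsto : ∀ π ∈ SpectralRisk.couplings μ ν,
      Tendsto (fun n => eLpNorm (Ln n - L) 1 (π : Measure (X × Y))) atTop (𝓝 0)) :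
    ((∀ n, SpectralRisk.maxSpectralRisk σ (Ln n) (μn n) (νn n) ≠ ⊥ ∧
        SpectralRisk.maxSpectralRisk σ (Ln n) (μn n) (νn n) ≠ ⊤) ∧
      SpectralRisk.maxSpectralRisk σ L μ ν ≠ ⊥ ∧
      SpectralRisk.maxSpectralRisk σ L μ ν ≠ ⊤ ∧
      Tendsto (fun n => SpectralRisk.maxSpectralRisk σ (Ln n) (μn n) (νn n)) atTop
        (𝓝 (SpectralRisk.maxSpectralRisk σ L μ ν))) ∧
    ∀ πn : ℕ → ProbabilityMeasure (X × Y),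
      (∀ n, SpectralRisk.IsMaximizer σ (Ln n) (μn n) (νn n) (πn n)) →
      ∃ φ : ℕ → ℕ, StrictMono φ ∧
        ∃ π : ProbabilityMeasure (X × Y),
          SpectralRisk.IsMaximizer σ L μ ν π ∧
          Tendsto (fun k => SpectralRisk.wasserstein r (πn (φ k)) π) atTop (𝓝 0) := by
  have hr0 : 0 < r := by linarith
  have hqr : (q : ℝ) ≤ r := (by exact_mod_cast hq1 : (q : ℝ) ≤ 1).trans hr
  have : SecondCountableTopology X := UniformSpace.secondCountable_of_separable X
  have : SecondCountableTopology Y := UniformSpace.secondCountable_of_separable Y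
  have hLi : ∀ π ∈ SpectralRisk.couplings μ ν, Integrable L (π : Measure (X × Y)) := by
    intro π hπ
    obtain ⟨n, hn⟩ := ((hLn_tendsto π hπ).eventually (gt_mem_nhds zero_lt_one)).exists
    have hmem : MemLp (Ln n - L) 1 (π : Measure (X × Y)) :=
      ⟨((hHolder n).continuous hq0).aestronglyMeasurable.sub hL.aestronglyMeasurable,
        hn.trans ENNReal.one_lt_top⟩
    have := (hLn_int n π hπ).sub (memLp_one_iff_integrable.1 hmem)
    rwa [sub_sub_cancel] at this
  have hcont (ψ : ℕ → ℕ) (hψ : Tendsto ψ atTop atTop) (ρ : ℕ → ProbabilityMeasure (X × Y))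
      (hρ : ∀ k, ρ k ∈ SpectralRisk.couplings (μn (ψ k)) (νn (ψ k)))
      (π : ProbabilityMeasure (X × Y)) (hπ : π ∈ SpectralRisk.couplings μ ν)
      (hW : Tendsto (fun k => SpectralRisk.wasserstein r (ρ k) π) atTop (𝓝 0)) :
      Tendsto (fun k => (SpectralRisk.spectralRisk σ (ρ k) (Ln (ψ k)) : EReal)) atTop
        (𝓝 (SpectralRisk.spectralRisk σ π L : EReal)) :=
    (continuous_coe_real_ereal.tendsto _).comp
      (SpectralRisk.tendsto_spectralRisk hr0 hW hL hq0 hqr (fun k => hHolder (ψ k))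
        (fun k => hLn_int_n _ _ (hρ k)) (fun k => hLn_int _ π hπ) (hLi π hπ)
        ((hLn_tendsto π hπ).comp hψ) hσ)
  have hfin_n (n : ℕ) : SpectralRisk.maxSpectralRisk σ (Ln n) (μn n) (νn n) ≠ ⊥ ∧
      SpectralRisk.maxSpectralRisk σ (Ln n) (μn n) (νn n) ≠ ⊤ := by
    obtain ⟨B, hB, hbd⟩ := SpectralRisk.exists_bound_edist_spectralRisk hr0 (hμn n) (hνn n) hσ C
      hq0 hqr
    exact SpectralRisk.maxSpectralRisk_ne_bot_and_ne_top hB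
      (hbd (Ln n) (hHolder n) (hLn_int_n n))
  have hfin : SpectralRisk.maxSpectralRisk σ L μ ν ≠ ⊥ ∧
      SpectralRisk.maxSpectralRisk σ L μ ν ≠ ⊤ := by
    obtain ⟨B, hB, hbd⟩ := SpectralRisk.exists_bound_edist_spectralRisk hr0 hμ hν hσ C hq0 hqr
    -- `L` is not assumed Hölder, so its oscillation bound is obtained as the limit of the uniform
    -- bounds for `Ln`, along a constant sequence of couplings.
    have hR (π : ProbabilityMeasure (X × Y)) (hπ : π ∈ SpectralRisk.couplings μ ν) :
        Tendsto (fun n => SpectralRisk.spectralRisk σ π (Ln n)) atTop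
          (𝓝 (SpectralRisk.spectralRisk σ π L)) :=
      SpectralRisk.tendsto_spectralRisk (πn := fun _ => π) hr0
        (by simp only [SpectralRisk.wasserstein_self hr0]; exact tendsto_const_nhds) hL hq0 hqr
        hHolder (fun n => hLn_int n π hπ) (fun n => hLn_int n π hπ) (hLi π hπ)
        (hLn_tendsto π hπ) hσ
    refine SpectralRisk.maxSpectralRisk_ne_bot_and_ne_top hB fun π hπ π' hπ' => ?_
    exact le_of_tendsto ((hR π hπ).edist (hR π' hπ'))
      (Eventually.of_forall fun n => hbd (Ln n) (hHolder n) (hLn_int n) π hπ π' hπ')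
  have hle_max {f : X × Y → ℝ} {a : ProbabilityMeasure X} {b : ProbabilityMeasure Y}
      {π : ProbabilityMeasure (X × Y)} (hπ : π ∈ SpectralRisk.couplings a b) :
      (SpectralRisk.spectralRisk σ π f : EReal) ≤ SpectralRisk.maxSpectralRisk σ f a b :=
    le_iSup₂ (f := fun π (_ : π ∈ SpectralRisk.couplings a b) =>
      (SpectralRisk.spectralRisk σ π f : EReal)) π hπ
  have hconv : Tendsto (fun n => SpectralRisk.maxSpectralRisk σ (Ln n) (μn n) (νn n)) atTop
      (𝓝 (SpectralRisk.maxSpectralRisk σ L μ ν)) := by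
    refine tendsto_order.2 ⟨fun a ha => ?_, fun b hb => ?_⟩
    -- Lower bound: a nearly optimal `π` is approximated by feasible couplings of the perturbed
    -- marginals.
    · obtain ⟨π, hπ, haπ⟩ := lt_biSup_iff.1 ha
      obtain ⟨πn, hπn, hW⟩ := SpectralRisk.exists_couplings_tendsto_wasserstein hr0 hWμ hWν hπ
      filter_upwards [(hcont id tendsto_id πn hπn π hπ hW).eventually (lt_mem_nhds haπ)] with n hn
      exact hn.trans_le (hle_max (hπn n))
    · by_contra hcon
      obtain ⟨ψ, hψ, hψb⟩ := extraction_of_frequently_atTop (not_eventually.1 hcon)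
      -- The intermediate level `b'` keeps a strict gap after the limit turns the risk inequality
      -- into a weak one.
      obtain ⟨b', hb', hb'b⟩ := exists_between hb
      have hex (k : ℕ) : ∃ ρ ∈ SpectralRisk.couplings (μn (ψ k)) (νn (ψ k)),
          b' < (SpectralRisk.spectralRisk σ ρ (Ln (ψ k)) : EReal) := by
        obtain ⟨ρ, hρ, hlt⟩ := lt_biSup_iff.1 (hb'b.trans_le (not_lt.1 (hψb k)))
        exact ⟨ρ, hρ, hlt⟩
      choose ρ hρ hρb using hex
      obtain ⟨φ, hφ, π, hπ, hW⟩ := SpectralRisk.exists_subseq_tendsto_wasserstein hr0 hμ hν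
        (hWμ.comp hψ.tendsto_atTop) (hWν.comp hψ.tendsto_atTop) hρ
      have hlim := hcont (ψ ∘ φ) (hψ.comp hφ).tendsto_atTop (ρ ∘ φ) (fun k => hρ (φ k)) π hπ hW
      have hge := ge_of_tendsto hlim (Eventually.of_forall fun k => (hρb (φ k)).le)
      exact absurd (hge.trans (hle_max hπ)) (not_le.2 hb')
  refine ⟨⟨hfin_n, hfin.1, hfin.2, hconv⟩, fun πn hπn => ?_⟩
  obtain ⟨φ, hφ, π, hπ, hW⟩ := SpectralRisk.exists_subseq_tendsto_wasserstein hr0 hμ hν hWμ hWν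
    (fun n => (hπn n).1)
  refine ⟨φ, hφ, π, ⟨hπ, ?_⟩, hW⟩
  have hlim := hcont φ hφ.tendsto_atTop (πn ∘ φ) (fun k => (hπn (φ k)).1) π hπ hW
  -- The risks of the maximizers are the optimal values, so their limit is both the risk of `π` and
  -- the limiting optimum.
  refine tendsto_nhds_unique (hlim.congr fun k => ?_) (hconv.comp hφ.tendsto_atTop)
  exact (hπn (φ k)).2
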